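/- Let $E=(E^0,E^1,s,r)$ be an arbitrary oriented graph and let $F$ be a commutative unital ring. Let $R=\bigoplus_{v\in E^0}F\mathbf 1_v$ with pointwise multiplication (a possibly non-unital ring), $Q=\bigoplus_{e\in E^1}F\mathbf 1_e$ and $P=\bigoplus_{e\in E^1}F\mathbf 1_{\bar e}$, where $Q$ and $P$ are $R$-bimodules with $F$-bilinear actions determined by $$\mathbf 1_v\mathbf 1_e=\delta_{v,s(e)}\mathbf 1_e,\quad \mathbf 1_e\mathbf 1_v=\delta_{v,r(e)}\mathbf 1_e,\quad \mathbf 1_v\mathbf 1_{\bar e}=\delta_{v,r(e)}\mathbf 1_{\bar e},\quad \mathbf 1_{\bar e}\mathbf 1_v=\delta_{v,s(e)}\mathbf 1_{\bar e},$$ and let $\psi:P\otimes_RQ\to R$ be the $F$-linear $R$-bimodule homomorphism with $\psi(\mathbf 1_{\bar e}\otimes\mathbf 1_f)=\delta_{e,f}\mathbf 1_{r(e)}$. Let $\mathcal F_P(Q)$ be the additive span of the maps $\theta_{q,p}:Q\to Q$, $x\mapsto q\,\psi(p\otimes x)$, let $\mathcal F_Q(P)$ be the additive span of the maps $\theta_{p,q}:P\to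 P$, $y\mapsto\psi(y\otimes q)\,p$, and let $\Delta(a):Q\to Q$, $q\mapsto aq$, for $a\in R$. Condition (FS) says that for all finite sets $\{q_i\}\subseteq Q$ and $\{p_j\}\subseteq P$ there are $\Theta\in\mathcal F_P(Q)$ and $\Omega\in\mathcal F_Q(P)$ with $\Theta(q_i)=q_i$ and $\Omega(p_j)=p_j$ for all $i,j$. A two-sided ideal $J$ of $R$ is $\psi$-compatible if $J\subseteq\Delta^{-1}(\mathcal F_P(Q))$, faithful if $J\cap\ker\Delta=0$, and uniquely maximal if it is faithful and $\psi$-compatible and contains every faithful $\psi$-compatible two-sided ideal. Write $(\ker\Delta)^\perp=\{a\in R: ab=ba=0\text{ for all }b\in\ker\Delta\}$. A covariant representation of $(P,Q,\psi)$ on a ring $B$ consists of additive maps $S:P\to B$, $T:Q\to B$ and a ring homomorphism $\sigma:R\to B$ that are compatible with the bimodule actions and satisfy $S(p)T(q)=\sigma(\psi(p\otimes q))$. The Toeplitz ring $\mathcal T_{(P,Q,\psi)}$ is the ring carrying the universal covariant representation $(\iota_P,\iota_Q,\iota_R)$. If (FS) holds and $J$ is $\psi$-compatible, then $\mathcal O_{(P,Q,\psi)}(J)$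 is the quotient of $\mathcal T_{(P,Q,\psi)}$ by the two-sided ideal generated by all $\iota_R(x)-\pi(\Delta(x))$ with $x\in J$, where $\pi:\mathcal F_P(Q)\to\mathcal T_{(P,Q,\psi)}$ is the additive map with $\pi(\theta_{q,p})=\iota_Q(q)\iota_P(p)$. If $J$ is uniquely maximal, then $\mathcal O_{(P,Q,\psi)}:=\mathcal O_{(P,Q,\psi)}(J)$ is the Cuntz–Pimsner ring. Write $\iota_R^J,\iota_Q^J,\iota_P^J$ for the maps into the quotient. Then: 1. $\Delta^{-1}(\mathcal F_P(Q))=\operatorname{span}_F\{\mathbf 1_v:|s^{-1}(v)|<\infty\}$, $\ker\Delta=\operatorname{span}_F\{\mathbf 1_v:|s^{-1}(v)|=0\}$ and $(\ker\Delta)^\perp=\operatorname{span}_F\{\mathbf 1_v:|s^{-1}(v)|>0\}$. 2. $(P,Q,\psi)$ satisfies condition (FS). 3. There is a uniquely maximal faithful $\psi$-compatible two-sided ideal $J$ of $R$, and $J=\Delta^{-1}(\mathcal F_P(Q))\cap(\ker\Delta)^\perp=\operatorname{span}_F\{\mathbf 1_v:0<|s^{-1}(v)|<\infty\}$. 4.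 $\mathcal O_{(P,Q,\psi)}=\mathcal O_{(P,Q,\psi)}(J)$ carries an $F$-algebra structure with $c\,\iota_R^J(a)=\iota_R^J(ca)$, $c\,\iota_P^J(p)=\iota_P^J(cp)$ and $c\,\iota_Q^J(q)=\iota_Q^J(cq)$ for $c\in F$, $a\in R$, $p\in P$, $q\in Q$. With this structure it is isomorphic as an $F$-algebra to the Leavitt path algebra $L_F(E)$, by an isomorphism with $\iota_R^J(\mathbf 1_v)\mapsto p_v$, $\iota_Q^J(\mathbf 1_e)\mapsto x_e$ and $\iota_P^J(\mathbf 1_{\bar e})\mapsto y_e$. Here $L_F(E)$ is the universal (not necessarily unital) associative $F$-algebra generated by pairwise orthogonal idempotents $p_v$ ($v\in E^0$) and elements $x_e,y_e$ ($e\in E^1$) subject to $p_{s(e)}x_e=x_e=x_ep_{r(e)}$ and $p_{r(e)}y_e=y_e=y_ep_{s(e)}$ for all $e$, $y_ex_f=\delta_{e,f}p_{r(e)}$ for all $e,f$, and $p_v=\sum_{e\in s^{-1}(v)}x_ey_e$ for all $v$ with $0<|s^{-1}(v)|<\infty$. -/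

import Mathlib

/-! ### Systems over a (possibly non-unital) ring -/

/-- The structure of an `R`-bimodule on an abelian group `M`, for a ring `R` that need not have
a unit: biadditive, associative and commuting left and right actions. -/
structure Bimodule (R M : Type*) [NonUnitalRing R] [AddCommGroup M] where
  /-- the left action, `left r m = r m` -/
  left : R →+ M →+ M
  /-- the right action, `right m r = m r` -/
  right : M →+ R →+ M
  mul_left : ∀ r s m, left (r * s) m = left r (left s m)
  right_mul : ∀ m r s, right m (r * s) = right (right m r) s
  left_right : ∀ r m s, right (left r m) s = left r (right m s)

/-- An `R`-system `(P, Q, ψ)`: two `R`-bimodules `P` and `Q` and an `R`-bimodule homomorphism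
`ψ : P ⊗_R Q → R`.  The homomorphism is given by the `R`-balanced biadditive map
`(p, q) ↦ ψ (p ⊗ q)`, which is the same thing by the definition of the balanced tensor product. -/
structure RSystem (R P Q : Type*) [NonUnitalRing R] [AddCommGroup P] [AddCommGroup Q] where
  bimodP : Bimodule R P
  bimodQ : Bimodule R Q
  psi : P →+ Q →+ R
  psi_balanced : ∀ p r q, psi (bimodP.right p r) q = psi p (bimodQ.left r q)
  psi_left : ∀ r p q, psi (bimodP.left r p) q = r * psi p q
  psi_right : ∀ p q r, psi p (bimodQ.right q r) = psi p q * r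

/-- A covariant representation `(S, T, σ, B)` of an `R`-system on a ring `B`. -/
structure CovariantRep {R P Q : Type*} [NonUnitalRing R] [AddCommGroup P] [AddCommGroup Q]
    (X : RSystem R P Q) (B : Type*) [NonUnitalRing B] where
  S : P →+ B
  T : Q →+ B
  σ : R →ₙ+* B
  S_right : ∀ p r, S (X.bimodP.right p r) = S p * σ r
  S_left : ∀ r p, S (X.bimodP.left r p) = σ r * S p
  T_right : ∀ q r, T (X.bimodQ.right q r) = T q * σ r
  T_left : ∀ r q, T (X.bimodQ.left r q) = σ r * T q
  σ_psi : ∀ p q, σ (X.psi p q) = S p * T q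

namespace RSystem

variable {R P Q : Type*} [NonUnitalRing R] [AddCommGroup P] [AddCommGroup Q]
variable (X : RSystem R P Q)

/-! ### Finite rank homomorphisms and condition (FS) -/

/-- `θ_{q,p} : Q → Q`, `x ↦ q ψ(p ⊗ x)`. -/
def theta (q : Q) (p : P) : Q →+ Q := (X.bimodQ.right q).comp (X.psi p)

/-- `θ_{p,q} : P → P`, `y ↦ ψ(y ⊗ q) p`. -/
def thetaAdj (p : P) (q : Q) : P →+ P := (X.bimodP.left.flip p).comp (X.psi.flip q)

/-- `𝓕_P(Q)`: the additive span of the `θ_{q,p}`. -/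
def finiteRank : AddSubgroup (Q →+ Q) :=
  AddSubgroup.closure (Set.range fun x : Q × P => X.theta x.1 x.2)

/-- `𝓕_Q(P)`: the additive span of the `θ_{p,q}`. -/
def finiteRankAdj : AddSubgroup (P →+ P) :=
  AddSubgroup.closure (Set.range fun x : P × Q => X.thetaAdj x.1 x.2)

/-- Condition (FS). -/
def FS : Prop :=
  ∀ (s : Finset Q) (t : Finset P),
    ∃ Θ ∈ X.finiteRank, ∃ Ω ∈ X.finiteRankAdj, (∀ q ∈ s, Θ q = q) ∧ ∀ p ∈ t, Ω p = p

/-- `Δ(r) : Q → Q`, `q ↦ r q`. -/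
def Delta (r : R) : Q →+ Q := X.bimodQ.left r

/-- A two-sided ideal `J` is `ψ`-compatible if `J ⊆ Δ⁻¹(𝓕_P(Q))`. -/
def IsPsiCompatible (J : TwoSidedIdeal R) : Prop := ∀ x ∈ J, X.Delta x ∈ X.finiteRank

/-- A two-sided ideal `J` is faithful if `J ∩ ker Δ = 0`. -/
def IsFaithful (J : TwoSidedIdeal R) : Prop := ∀ x ∈ J, X.Delta x = 0 → x = 0

/-- `J` is a uniquely maximal faithful `ψ`-compatible two-sided ideal: it is the largest
faithful `ψ`-compatible two-sided ideal. -/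
structure IsUniquelyMaximal (J : TwoSidedIdeal R) : Prop where
  compatible : X.IsPsiCompatible J
  faithful : X.IsFaithful J
  le_of : ∀ J' : TwoSidedIdeal R, X.IsPsiCompatible J' → X.IsFaithful J' → J' ≤ J

end RSystem

/-! ### The map `π_{T,S} : 𝓕_P(Q) → B`, `θ_{q,p} ↦ T(q) S(p)` -/

namespace CovariantRep

variable {R P Q : Type*} [NonUnitalRing R] [AddCommGroup P] [AddCommGroup Q]
variable {X : RSystem R P Q} {B : Type*} [NonUnitalRing B]

/-- The surjection `∑ [q, p] ↦ ∑ θ_{q,p}` from formal sums of pairs onto `𝓕_P(Q)`. -/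
def thetaSum (X : RSystem R P Q) : FreeAbelianGroup (Q × P) →+ X.finiteRank :=
  FreeAbelianGroup.lift fun x =>
    ⟨X.theta x.1 x.2, AddSubgroup.subset_closure (Set.mem_range_self x)⟩

theorem thetaSum_surjective (X : RSystem R P Q) : Function.Surjective (thetaSum X) := by
  rintro ⟨Θ, hΘ⟩
  have h : ∃ t, ((thetaSum X t : X.finiteRank) : Q →+ Q) = Θ := by
    refine AddSubgroup.closure_induction (p := fun Θ _ =>
      ∃ t, ((thetaSum X t : X.finiteRank) : Q →+ Q) = Θ) ?_ ?_ ?_ ?_ hΘ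
    · rintro _ ⟨x, rfl⟩
      exact ⟨FreeAbelianGroup.of x, by simp [thetaSum]⟩
    · exact ⟨0, by simp⟩
    · rintro _ _ _ _ ⟨t, rfl⟩ ⟨u, rfl⟩
      exact ⟨t + u, by simp⟩
    · rintro _ _ ⟨t, rfl⟩
      exact ⟨-t, by simp⟩
  obtain ⟨t, ht⟩ := h
  exact ⟨t, Subtype.ext ht⟩

/-- `∑ [q, p] ↦ ∑ T(q) S(p)`. -/
def prodSum (ρ : CovariantRep X B) : FreeAbelianGroup (Q × P) →+ B :=
  FreeAbelianGroup.lift fun x => ρ.T x.1 * ρ.S x.2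

/-- Under condition (FS), `∑ θ_{q,p} = 0` implies `∑ T(q) S(p) = 0`. -/
theorem ker_thetaSum_le (hX : X.FS) (ρ : CovariantRep X B) :
    (thetaSum X).ker ≤ ρ.prodSum.ker := by
  intro t ht
  rw [AddMonoidHom.mem_ker] at ht ⊢
  let N : (P →+ P) → FreeAbelianGroup (Q × P) →+ B := fun Ω =>
    FreeAbelianGroup.lift fun x => ρ.T x.1 * ρ.S (Ω x.2)
  have hfix : ∀ t : FreeAbelianGroup (Q × P), ∃ s : Finset P, ∀ Ω : P →+ P,
      (∀ p ∈ s, Ω p = p) → N Ω t = ρ.prodSum t := by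
    classical
    intro t
    induction t using FreeAbelianGroup.induction_on with
    | zero => exact ⟨∅, fun Ω _ => by simp⟩
    | of x =>
      refine ⟨{x.2}, fun Ω h => ?_⟩
      simp [N, prodSum, h x.2 (by simp)]
    | neg x h =>
      obtain ⟨s, hs⟩ := h
      exact ⟨s, fun Ω h => by rw [map_neg, map_neg, hs Ω h]⟩
    | add x y hx hy =>
      obtain ⟨s, hs⟩ := hx
      obtain ⟨u, hu⟩ := hy
      refine ⟨s ∪ u, fun Ω h => ?_⟩
      rw [map_add, map_add, hs Ω fun p hp => h p (by simp [hp]),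
        hu Ω fun p hp => h p (by simp [hp])]
  have hone : ∀ (p : P) (q : Q) (u : FreeAbelianGroup (Q × P)),
      N (X.thetaAdj p q) u = ρ.T ((thetaSum X u : Q →+ Q) q) * ρ.S p := by
    intro p q u
    induction u using FreeAbelianGroup.induction_on with
    | zero => simp
    | of x =>
      simp [N, thetaSum, RSystem.theta, RSystem.thetaAdj, ρ.S_left, ρ.T_right, mul_assoc]
    | neg x h => rw [map_neg, h]; simp
    | add x y hx hy => rw [map_add, hx, hy]; simp [add_mul]
  have hzero : ∀ Ω ∈ X.finiteRankAdj, N Ω t = 0 := by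
    intro Ω hΩ
    have hN0 : ∀ u, N 0 u = 0 := by
      intro u
      induction u using FreeAbelianGroup.induction_on with
      | zero => simp
      | of x => simp [N]
      | neg x h => rw [map_neg, h, neg_zero]
      | add x y hx hy => rw [map_add, hx, hy, add_zero]
    have hNadd : ∀ Ω₁ Ω₂ u, N (Ω₁ + Ω₂) u = N Ω₁ u + N Ω₂ u := by
      intro Ω₁ Ω₂ u
      induction u using FreeAbelianGroup.induction_on with
      | zero => simp
      | of x => simp [N, mul_add]
      | neg x h => rw [map_neg, map_neg, map_neg, h, neg_add]
      | add x y hx hy => rw [map_add, map_add, map_add, hx, hy]; abel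
    refine AddSubgroup.closure_induction (p := fun Ω _ => N Ω t = 0) ?_ (hN0 t) ?_ ?_ hΩ
    · rintro _ ⟨x, rfl⟩
      rw [hone, ht]; simp
    · intro Ω₁ Ω₂ _ _ h₁ h₂
      rw [hNadd, h₁, h₂, add_zero]
    · intro Ω₁ _ h
      have h2 := hNadd Ω₁ (-Ω₁) t
      rw [add_neg_cancel, hN0, h, zero_add] at h2
      exact h2.symm
  obtain ⟨s, hs⟩ := hfix t
  obtain ⟨_, _, Ω, hΩ, _, hΩs⟩ := hX ∅ s
  rw [← hs Ω hΩs, hzero Ω hΩ]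

/-- For a system with (FS), the additive map `π_{T,S} : 𝓕_P(Q) → B` with
`π_{T,S}(θ_{q,p}) = T(q) S(p)`. -/
noncomputable def pi (hX : X.FS) (ρ : CovariantRep X B) : X.finiteRank →+ B :=
  (thetaSum X).liftOfSurjective (thetaSum_surjective X) ⟨ρ.prodSum, ker_thetaSum_le hX ρ⟩

theorem pi_theta (hX : X.FS) (ρ : CovariantRep X B) (q : Q) (p : P)
    (h : X.theta q p ∈ X.finiteRank) : pi hX ρ ⟨X.theta q p, h⟩ = ρ.T q * ρ.S p := by
  have h1 : (⟨X.theta q p, h⟩ : X.finiteRank) = thetaSum X (FreeAbelianGroup.of (q, p)) := by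
    simp [thetaSum]
  rw [h1]
  unfold pi
  erw [AddMonoidHom.liftOfRightInverse_comp_apply]
  simp [prodSum]

end CovariantRep

/-! ### The Toeplitz ring -/

namespace RSystem

variable {R P Q : Type*} [NonUnitalRing R] [AddCommGroup P] [AddCommGroup Q]
variable (X : RSystem R P Q)

/-- The free (non-unital) ring on the disjoint union of `R`, `P` and `Q`. -/
abbrev FreeRng (_X : RSystem R P Q) : Type _ := MonoidAlgebra ℤ (FreeSemigroup (R ⊕ P ⊕ Q))

/-- the generators coming from `R` -/
noncomputable def genR (r : R) : X.FreeRng := MonoidAlgebra.single (FreeSemigroup.of (Sum.inl r)) 1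

/-- the generators coming from `P` -/
noncomputable def genP (p : P) : X.FreeRng :=
  MonoidAlgebra.single (FreeSemigroup.of (Sum.inr (Sum.inl p))) 1

/-- the generators coming from `Q` -/
noncomputable def genQ (q : Q) : X.FreeRng :=
  MonoidAlgebra.single (FreeSemigroup.of (Sum.inr (Sum.inr q))) 1

/-- The relations which say that the generators form a covariant representation. -/
inductive ToeplitzRel : X.FreeRng → X.FreeRng → Prop
  | add_R (r s : R) : ToeplitzRel (X.genR (r + s)) (X.genR r + X.genR s)
  | mul_R (r s : R) : ToeplitzRel (X.genR (r * s)) (X.genR r * X.genR s)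
  | add_P (p p' : P) : ToeplitzRel (X.genP (p + p')) (X.genP p + X.genP p')
  | add_Q (q q' : Q) : ToeplitzRel (X.genQ (q + q')) (X.genQ q + X.genQ q')
  | right_P (p : P) (r : R) : ToeplitzRel (X.genP (X.bimodP.right p r)) (X.genP p * X.genR r)
  | left_P (r : R) (p : P) : ToeplitzRel (X.genP (X.bimodP.left r p)) (X.genR r * X.genP p)
  | right_Q (q : Q) (r : R) : ToeplitzRel (X.genQ (X.bimodQ.right q r)) (X.genQ q * X.genR r)
  | left_Q (r : R) (q : Q) : ToeplitzRel (X.genQ (X.bimodQ.left r q)) (X.genR r * X.genQ q)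
  | psi (p : P) (q : Q) : ToeplitzRel (X.genR (X.psi p q)) (X.genP p * X.genQ q)

/-- The Toeplitz ring `𝓣_{(P,Q,ψ)}`: the universal ring carrying a covariant representation. -/
abbrev Toeplitz : Type _ := (ringConGen X.ToeplitzRel).Quotient

/-- the quotient map onto the Toeplitz ring -/
noncomputable def toToeplitz : X.FreeRng →ₙ+* X.Toeplitz where
  toFun x := (x : (ringConGen X.ToeplitzRel).Quotient)
  map_mul' _ _ := rfl
  map_zero' := rfl
  map_add' _ _ := rfl

theorem toToeplitz_eq {x y : X.FreeRng} (h : X.ToeplitzRel x y) :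
    X.toToeplitz x = X.toToeplitz y :=
  (RingCon.eq _).2 (RingConGen.Rel.of _ _ h)

/-- The Toeplitz representation `(ι_P, ι_Q, ι_R, 𝓣_{(P,Q,ψ)})`. -/
noncomputable def toeplitzRep : CovariantRep X X.Toeplitz where
  S := AddMonoidHom.mk' (fun p => X.toToeplitz (X.genP p)) fun p p' => by
    rw [X.toToeplitz_eq (.add_P p p'), map_add]
  T := AddMonoidHom.mk' (fun q => X.toToeplitz (X.genQ q)) fun q q' => by
    rw [X.toToeplitz_eq (.add_Q q q'), map_add]
  σ :=
    { AddMonoidHom.mk' (fun r => X.toToeplitz (X.genR r)) fun r s => by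
        rw [X.toToeplitz_eq (.add_R r s), map_add] with
      map_mul' := fun r s => (X.toToeplitz_eq (.mul_R r s)).trans (map_mul _ _ _) }
  S_right p r := (X.toToeplitz_eq (.right_P p r)).trans (map_mul _ _ _)
  S_left r p := (X.toToeplitz_eq (.left_P r p)).trans (map_mul _ _ _)
  T_right q r := (X.toToeplitz_eq (.right_Q q r)).trans (map_mul _ _ _)
  T_left r q := (X.toToeplitz_eq (.left_Q r q)).trans (map_mul _ _ _)
  σ_psi p q := (X.toToeplitz_eq (.psi p q)).trans (map_mul _ _ _)

/-- The Toeplitz ring is universal: every covariant representation factors through the Toeplitz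
representation in exactly one way. -/
theorem existsUnique_toeplitz_lift {B : Type*} [NonUnitalRing B] (ρ : CovariantRep X B) :
    ∃! η : X.Toeplitz →ₙ+* B, (∀ r, η (X.toeplitzRep.σ r) = ρ.σ r) ∧
      (∀ q, η (X.toeplitzRep.T q) = ρ.T q) ∧ ∀ p, η (X.toeplitzRep.S p) = ρ.S p := by
  let g : R ⊕ P ⊕ Q → B := Sum.elim ρ.σ (Sum.elim ρ.S ρ.T)
  let f : X.FreeRng →ₙₐ[ℤ] B := MonoidAlgebra.liftMagma ℤ (FreeSemigroup.lift g)
  have hf : ∀ x, f (MonoidAlgebra.single (FreeSemigroup.of x) 1) = g x := by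
    intro x; simp [f]
  have hR : ∀ r, f (X.genR r) = ρ.σ r := fun r => hf _
  have hP : ∀ p, f (X.genP p) = ρ.S p := fun p => hf _
  have hQ : ∀ q, f (X.genQ q) = ρ.T q := fun q => hf _
  have hker : ∀ x y, RingConGen.Rel X.ToeplitzRel x y → f x = f y := by
    intro x y h
    induction h with
    | of x y h =>
      cases h <;> simp only [map_add, map_mul, hR, hP, hQ, ρ.S_right, ρ.S_left, ρ.T_right,
        ρ.T_left, ρ.σ_psi]
    | refl x => rfl
    | symm _ ih => exact ih.symm
    | trans _ _ ih₁ ih₂ => exact ih₁.trans ih₂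
    | add _ _ ih₁ ih₂ => rw [map_add, map_add, ih₁, ih₂]
    | mul _ _ ih₁ ih₂ => rw [map_mul, map_mul, ih₁, ih₂]
  let η : X.Toeplitz →ₙ+* B :=
    { toFun := fun x => Quotient.liftOn' x f hker
      map_mul' := by rintro ⟨x⟩ ⟨y⟩; exact map_mul f x y
      map_zero' := map_zero f
      map_add' := by rintro ⟨x⟩ ⟨y⟩; exact map_add f x y }
  refine ⟨η, ⟨hR, hQ, hP⟩, ?_⟩
  rintro η' ⟨h1, h2, h3⟩
  have key : ∀ x : X.FreeRng, η' (X.toToeplitz x) = f x := by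
    intro x
    induction x using MonoidAlgebra.induction_linear with
    | zero => simp
    | add x y hx hy => rw [map_add, map_add, map_add, hx, hy]
    | single w n =>
      have hw : ∀ w : FreeSemigroup (R ⊕ P ⊕ Q),
          η' (X.toToeplitz (MonoidAlgebra.single w 1)) = f (MonoidAlgebra.single w 1) := by
        intro w
        induction w using FreeSemigroup.recOnMul with
        | ih1 x =>
          rw [hf]
          rcases x with r | p | q
          · exact h1 r
          · exact h3 p
          · exact h2 q
        | ih2 x y hx hy =>
          have hs : (MonoidAlgebra.single (FreeSemigroup.of x * y) 1 : X.FreeRng) =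
              MonoidAlgebra.single (FreeSemigroup.of x) 1 * MonoidAlgebra.single y 1 := by
            simp
          rw [hs, map_mul, map_mul, map_mul, hx, hy]
      have hn : (MonoidAlgebra.single w n : X.FreeRng) = n • MonoidAlgebra.single w 1 := by
        simp
      rw [hn, map_zsmul, map_zsmul, map_zsmul, hw]
  refine DFunLike.ext _ _ ?_
  rintro ⟨x⟩
  exact key x

/-! ### Relative Cuntz–Pimsner rings -/

variable {X}

/-- `𝓣(J)`: the two-sided ideal of the Toeplitz ring generated by the elements
`ι_R(x) - π(Δ(x))`, `x ∈ J`. -/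
noncomputable def toeplitzIdeal (hX : X.FS) (J : TwoSidedIdeal R) (hJ : X.IsPsiCompatible J) :
    TwoSidedIdeal X.Toeplitz :=
  TwoSidedIdeal.span (Set.range fun x : {x : R // x ∈ J} =>
    X.toeplitzRep.σ x.1 - X.toeplitzRep.pi hX ⟨X.Delta x.1, hJ x.1 x.2⟩)

/-- The Cuntz–Pimsner ring `𝓞_{(P,Q,ψ)}(J) = 𝓣_{(P,Q,ψ)} / 𝓣(J)` relative to `J`.  If `J` is
the uniquely maximal faithful `ψ`-compatible ideal, this is the Cuntz–Pimsner ring. -/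
abbrev RelCuntzPimsner (hX : X.FS) (J : TwoSidedIdeal R) (hJ : X.IsPsiCompatible J) : Type _ :=
  (toeplitzIdeal hX J hJ).ringCon.Quotient

/-- the quotient map `ρ_J : 𝓣_{(P,Q,ψ)} → 𝓞_{(P,Q,ψ)}(J)` -/
noncomputable def toRelCuntzPimsner (hX : X.FS) (J : TwoSidedIdeal R) (hJ : X.IsPsiCompatible J) :
    X.Toeplitz →ₙ+* RelCuntzPimsner hX J hJ where
  toFun x := (x : (toeplitzIdeal hX J hJ).ringCon.Quotient)
  map_mul' _ _ := rfl
  map_zero' := rfl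
  map_add' _ _ := rfl

/-- The Cuntz–Pimsner representation `(ι_P^J, ι_Q^J, ι_R^J, 𝓞_{(P,Q,ψ)}(J))` relative to `J`. -/
noncomputable def cuntzPimsnerRep (hX : X.FS) (J : TwoSidedIdeal R) (hJ : X.IsPsiCompatible J) :
    CovariantRep X (RelCuntzPimsner hX J hJ) where
  S := (toRelCuntzPimsner hX J hJ : X.Toeplitz →+ _).comp X.toeplitzRep.S
  T := (toRelCuntzPimsner hX J hJ : X.Toeplitz →+ _).comp X.toeplitzRep.T
  σ := (toRelCuntzPimsner hX J hJ).comp X.toeplitzRep.σ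
  S_right p r := by simp [X.toeplitzRep.S_right]
  S_left r p := by simp [X.toeplitzRep.S_left]
  T_right q r := by simp [X.toeplitzRep.T_right]
  T_left r q := by simp [X.toeplitzRep.T_left]
  σ_psi p q := by simp [X.toeplitzRep.σ_psi]

end RSystem

/-! ### Graphs -/

/-- An oriented graph with vertex set `V`, edge set `E`, source map `s` and range map `r`;
no finiteness is assumed. -/
structure OrientedGraph (V E : Type*) where
  s : E → V
  r : E → V

namespace OrientedGraph

variable {V E : Type*} (G : OrientedGraph V E) (F : Type*) [CommRing F]

/-- Multiplication of `∑ q_e 1_e` by `∑ a_v 1_v` along a map `f` from edges to vertices, that is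
`∑ a_{f e} q_e 1_e`, as a biadditive map. -/
noncomputable def actAlong {F : Type*} [CommRing F] (f : E → V) :
    (V →₀ F) →+ (E →₀ F) →+ (E →₀ F) :=
  AddMonoidHom.mk' (fun a => AddMonoidHom.mk'
    (fun q => Finsupp.onFinset q.support (fun e => a (f e) * q e) fun e he => by
      simp only [Finsupp.mem_support_iff]
      rintro h
      exact he (by rw [h, mul_zero]))
    fun q q' => by ext e; simp [mul_add])
    fun a b => by ext q e; simp [add_mul]

@[simp] theorem actAlong_apply {F : Type*} [CommRing F] (f : E → V) (a : V →₀ F) (q : E →₀ F)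
    (e : E) : actAlong f a q e = a (f e) * q e := by
  simp [actAlong]

theorem mapDomain_actAlong {F : Type*} [CommRing F] (f : E → V) (a : V →₀ F) (q : E →₀ F) :
    (actAlong f a q).mapDomain f = a * q.mapDomain f := by
  induction q using Finsupp.induction_linear with
  | zero => simp
  | add x y hx hy => rw [map_add, Finsupp.mapDomain_add, hx, hy, Finsupp.mapDomain_add, mul_add]
  | single e c =>
    have h : actAlong f a (Finsupp.single e c) = Finsupp.single e (a (f e) * c) := by
      classical
      ext e'
      by_cases he : e = e'
      · subst he; simp
      · simp [Finsupp.single_eq_of_ne' he]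
    rw [h, Finsupp.mapDomain_single, Finsupp.mapDomain_single]
    classical
    ext v
    by_cases hv : f e = v
    · subst hv; simp
    · simp [Finsupp.single_eq_of_ne' hv]

/-- The bimodule `⊕_{e ∈ E} F_e` over `R = ⊕_{v ∈ V} F_v` with `1_v 1_e = 1_e` if `f e = v` and
`0` otherwise, and `1_e 1_v = 1_e` if `g e = v` and `0` otherwise. -/
noncomputable def edgeBimodule (f g : E → V) : Bimodule (V →₀ F) (E →₀ F) where
  left := actAlong f
  right := (actAlong g).flip
  mul_left a b q := by ext e; simp [mul_assoc]
  right_mul q a b := by ext e; simp; ring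
  left_right a q b := by ext e; simp; ring

/-- The pairing `ψ(p ⊗ q) = ∑_v (∑_{r(e) = v} p_e q_e) 1_v`. -/
noncomputable def edgePairing : (E →₀ F) →+ (E →₀ F) →+ (V →₀ F) :=
  AddMonoidHom.mk' (fun p => AddMonoidHom.mk' (fun q => (p * q).mapDomain G.r)
    fun q q' => by rw [mul_add, Finsupp.mapDomain_add])
    fun p p' => by
      refine AddMonoidHom.ext fun q => ?_
      simp [add_mul, Finsupp.mapDomain_add]

/-- The `R`-system of a graph, where `R = ⊕_{v ∈ V} F_v` with pointwise multiplication,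
`Q = ⊕_{e ∈ E} F_e` and `P = ⊕_{e ∈ E} F_ē`. -/
noncomputable def system : RSystem (V →₀ F) (E →₀ F) (E →₀ F) where
  bimodP := edgeBimodule F G.r G.s
  bimodQ := edgeBimodule F G.s G.r
  psi := G.edgePairing F
  psi_balanced p a q := by
    have h : (edgeBimodule F G.r G.s).right p a * q = p * (edgeBimodule F G.s G.r).left a q := by
      ext e; simp [edgeBimodule]; ring
    simp [edgePairing, h]
  psi_left a p q := by
    have h : (edgeBimodule F G.r G.s).left a p * q = actAlong G.r a (p * q) := by
      ext e; simp [edgeBimodule, mul_assoc]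
    simp only [edgePairing, AddMonoidHom.mk'_apply, h, mapDomain_actAlong]
  psi_right p q a := by
    have h : p * (edgeBimodule F G.s G.r).right q a = actAlong G.r a (p * q) := by
      ext e; simp [edgeBimodule]; ring
    simp only [edgePairing, AddMonoidHom.mk'_apply, h, mapDomain_actAlong]
    rw [mul_comm]

/-- `span_F {1_v : v ∈ W}`, an `F`-submodule of `R = ⊕_{v ∈ V} F_v`. -/
noncomputable def vertexSpan (_G : OrientedGraph V E) (W : Set V) : Submodule F (V →₀ F) :=
  Submodule.span F ((fun v => Finsupp.single v 1) '' W)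

/-! ### Leavitt path algebras -/

/-- The generators of the Leavitt path algebra. -/
inductive LeavittGen (V E : Type*)
  | vertex (v : V) : LeavittGen V E
  | edge (e : E) : LeavittGen V E
  | ghost (e : E) : LeavittGen V E

/-- The free (non-unital) associative `F`-algebra on the vertices, edges and ghost edges. -/
abbrev LeavittFree (_G : OrientedGraph V E) : Type _ :=
  MonoidAlgebra F (FreeSemigroup (LeavittGen V E))

variable {F} in
/-- a generator of the free algebra -/
noncomputable def lgen (x : LeavittGen V E) : G.LeavittFree F :=
  MonoidAlgebra.single (FreeSemigroup.of x) 1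

open LeavittGen in
/-- The defining relations of the Leavitt path algebra. -/
inductive LeavittRel : G.LeavittFree F → G.LeavittFree F → Prop
  | vertex_self (v : V) : LeavittRel (G.lgen (vertex v) * G.lgen (vertex v)) (G.lgen (vertex v))
  | vertex_ne (v w : V) (h : v ≠ w) : LeavittRel (G.lgen (vertex v) * G.lgen (vertex w)) 0
  | source_edge (e : E) :
      LeavittRel (G.lgen (vertex (G.s e)) * G.lgen (edge e)) (G.lgen (edge e))
  | edge_range (e : E) :
      LeavittRel (G.lgen (edge e) * G.lgen (vertex (G.r e))) (G.lgen (edge e))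
  | range_ghost (e : E) :
      LeavittRel (G.lgen (vertex (G.r e)) * G.lgen (ghost e)) (G.lgen (ghost e))
  | ghost_source (e : E) :
      LeavittRel (G.lgen (ghost e) * G.lgen (vertex (G.s e))) (G.lgen (ghost e))
  | ghost_edge_self (e : E) :
      LeavittRel (G.lgen (ghost e) * G.lgen (edge e)) (G.lgen (vertex (G.r e)))
  | ghost_edge_ne (e f : E) (h : e ≠ f) : LeavittRel (G.lgen (ghost e) * G.lgen (edge f)) 0
  | vertex_sum (v : V) (hfin : {e | G.s e = v}.Finite) (hne : {e | G.s e = v}.Nonempty) :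
      LeavittRel (G.lgen (vertex v)) (∑ e ∈ hfin.toFinset, G.lgen (edge e) * G.lgen (ghost e))
  | smul (c : F) (x y : G.LeavittFree F) : LeavittRel x y → LeavittRel (c • x) (c • y)

/-- the congruence generated by the defining relations; it respects multiplication by scalars
since the set of relations does -/
noncomputable def leavittCon : RingCon (G.LeavittFree F) := ringConGen (G.LeavittRel F)

theorem leavittCon_smul (c : F) {x y : G.LeavittFree F} (h : G.leavittCon F x y) :
    G.leavittCon F (c • x) (c • y) := by
  change RingConGen.Rel _ x y at h
  change RingConGen.Rel _ (c • x) (c • y)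
  induction h with
  | of x y h => exact .of _ _ (.smul c x y h)
  | refl x => exact .refl _
  | symm _ ih => exact .symm ih
  | trans _ _ ih₁ ih₂ => exact .trans ih₁ ih₂
  | add _ _ ih₁ ih₂ => simpa only [smul_add] using RingConGen.Rel.add ih₁ ih₂
  | mul _ h₂ ih₁ _ => simpa only [smul_mul_assoc] using RingConGen.Rel.mul ih₁ h₂

/-- The Leavitt path algebra `L_F(G)`, a (non-unital) associative `F`-algebra. -/
def Leavitt : Type _ := (G.leavittCon F).Quotient

noncomputable instance : NonUnitalRing (G.Leavitt F) :=
  inferInstanceAs (NonUnitalRing (G.leavittCon F).Quotient)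

/-- the quotient map onto the Leavitt path algebra -/
noncomputable def toLeavitt : G.LeavittFree F →ₙ+* G.Leavitt F where
  toFun x := (x : (G.leavittCon F).Quotient)
  map_mul' _ _ := rfl
  map_zero' := rfl
  map_add' _ _ := rfl

theorem toLeavitt_surjective : Function.Surjective (G.toLeavitt F) := by
  rintro ⟨x⟩
  exact ⟨x, rfl⟩

noncomputable instance : SMul F (G.Leavitt F) :=
  ⟨fun c => Quotient.map' (c • ·) fun _ _ h => G.leavittCon_smul F c h⟩

theorem toLeavitt_smul (c : F) (x : G.LeavittFree F) :
    G.toLeavitt F (c • x) = c • G.toLeavitt F x := rfl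

noncomputable instance : Module F (G.Leavitt F) :=
  Function.Surjective.module F (G.toLeavitt F : G.LeavittFree F →+ G.Leavitt F)
    (G.toLeavitt_surjective F) (G.toLeavitt_smul F)

instance : IsScalarTower F (G.Leavitt F) (G.Leavitt F) where
  smul_assoc c x y := by
    obtain ⟨x, rfl⟩ := G.toLeavitt_surjective F x
    obtain ⟨y, rfl⟩ := G.toLeavitt_surjective F y
    simp only [smul_eq_mul, ← map_mul, ← toLeavitt_smul, smul_mul_assoc]

instance : SMulCommClass F (G.Leavitt F) (G.Leavitt F) where
  smul_comm c x y := by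
    obtain ⟨x, rfl⟩ := G.toLeavitt_surjective F x
    obtain ⟨y, rfl⟩ := G.toLeavitt_surjective F y
    simp only [smul_eq_mul, ← map_mul, ← toLeavitt_smul, mul_smul_comm]

/-- the idempotent `p_v` of the Leavitt path algebra -/
noncomputable def pv (v : V) : G.Leavitt F := G.toLeavitt F (G.lgen (.vertex v))

/-- the element `x_e` of the Leavitt path algebra -/
noncomputable def xe (e : E) : G.Leavitt F := G.toLeavitt F (G.lgen (.edge e))

/-- the element `y_e` of the Leavitt path algebra -/
noncomputable def ye (e : E) : G.Leavitt F := G.toLeavitt F (G.lgen (.ghost e))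

end OrientedGraph

/-! Everything is computed on the bases $\mathbf 1_v$, $\mathbf 1_e$, $\mathbf 1_{\bar e}$. The map
$\Delta(a)$ multiplies the coordinate at $e$ by $a_{s(e)}$, while $\theta_{\mathbf 1_e,\mathbf
1_{\bar e}}$ is the projection onto the coordinate at $e$. A finite rank map has its values
supported on a fixed finite set of edges, so $\Delta(a)$ can have finite rank only if each vertex in
the support of $a$ emits finitely many edges. Conversely, $\Delta(c\mathbf
1_v)=\sum_{s(e)=v}\theta_{c\mathbf 1_e,\mathbf 1_{\bar e}}$ for such $v$ (`Delta_single`). This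
settles the descriptions of the ideals. Condition (FS) holds because finite sums of coordinate
projections act as the identity on given finite sets.

The Cuntz–Pimsner ring is defined only as a ring, so its scalars must be constructed. Each element
$x$ has a finite vertex set $W$ such that $\sigma(\mathbf 1_W)x=x$ and $x$ commutes with
$\sigma(c\mathbf 1_{W'})$ for all $W'\supseteq W$ (`exists_hasLocalUnit_relCuntzPimsner`). Then
$cx:=\sigma(c\mathbf 1_W)x$ does not depend on $W$, and commutation makes multiplication
$F$-bilinear.

The isomorphism comes from two universal properties. A Leavitt family in an $F$-algebra extends
linearly to a covariant representation (`IsLeavittFamily.rep`). By the formula for $\Delta(c\mathbf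
1_v)$, invariance relative to $J$ amounts to the relation $p_v=\sum x_ey_e$ at vertices emitting a
finite nonzero number of edges (`σ_eq_pi_of_single`, `isLeavittFamily_of_rep`). The two induced
homomorphisms are inverse on generators. -/

namespace OrientedGraph

variable {V E : Type*} (G : OrientedGraph V E) (F : Type*) [CommRing F]

/-! ### The ideals attached to the system of a graph -/

theorem mem_vertexSpan_iff {W : Set V} {a : V →₀ F} :
    a ∈ G.vertexSpan F W ↔ ∀ v, a v ≠ 0 → v ∈ W := by
  unfold vertexSpan
  rw [← Finsupp.supported_eq_span_single, Finsupp.mem_supported]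
  simp [Set.subset_def]

theorem Delta_apply (a : V →₀ F) (q : E →₀ F) (e : E) :
    (G.system F).Delta a q e = a (G.s e) * q e :=
  actAlong_apply _ _ _ _

theorem Delta_eq_zero_iff {a : V →₀ F} : (G.system F).Delta a = 0 ↔ ∀ e, a (G.s e) = 0 := by
  constructor
  · intro h e
    have h1 := G.Delta_apply F a (Finsupp.single e 1) e
    rw [h] at h1
    simpa using h1.symm
  · intro h
    refine AddMonoidHom.ext fun q => Finsupp.ext fun e => ?_
    rw [Delta_apply, h, zero_mul]
    rfl

theorem theta_apply (q p x : E →₀ F) (e : E) :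
    (G.system F).theta q p x e = (p * x).mapDomain G.r (G.r e) * q e :=
  actAlong_apply _ _ _ _

theorem thetaAdj_apply (p q y : E →₀ F) (e : E) :
    (G.system F).thetaAdj p q y e = (y * q).mapDomain G.r (G.r e) * p e :=
  actAlong_apply _ _ _ _

theorem single_mul_eq (e : E) (c : F) (x : E →₀ F) :
    Finsupp.single e c * x = Finsupp.single e (c * x e) := by
  classical
  ext f
  by_cases h : e = f
  · subst h; simp
  · simp [Finsupp.single_eq_of_ne' h]

theorem mul_single_eq (e : E) (c : F) (x : E →₀ F) :
    x * Finsupp.single e c = Finsupp.single e (x e * c) := by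
  rw [mul_comm, single_mul_eq, mul_comm]

/-- The pairing of $\mathbf 1_{\bar e}$ with $x$ is $x_e\mathbf 1_{r(e)}$, and $\mathbf 1_{r(e)}$
fixes $\mathbf 1_e$ on the right. For $c=1$ this is the coordinate projection at $e$. -/
theorem theta_single (e : E) (c : F) (x : E →₀ F) :
    (G.system F).theta (Finsupp.single e c) (Finsupp.single e 1) x =
      Finsupp.single e (c * x e) := by
  ext f
  rw [theta_apply, single_mul_eq, Finsupp.mapDomain_single]
  by_cases h : e = f
  · subst h; simp [mul_comm]
  · simp [Finsupp.single_eq_of_ne' h]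

theorem thetaAdj_single (e : E) (c : F) (x : E →₀ F) :
    (G.system F).thetaAdj (Finsupp.single e c) (Finsupp.single e 1) x =
      Finsupp.single e (c * x e) := by
  ext f
  rw [thetaAdj_apply, mul_single_eq, Finsupp.mapDomain_single]
  by_cases h : e = f
  · subst h; simp [mul_comm]
  · simp [Finsupp.single_eq_of_ne' h]

theorem theta_mem_finiteRank (q p : E →₀ F) : (G.system F).theta q p ∈ (G.system F).finiteRank :=
  AddSubgroup.subset_closure (Set.mem_range_self (q, p))

theorem thetaAdj_mem_finiteRankAdj (p q : E →₀ F) :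
    (G.system F).thetaAdj p q ∈ (G.system F).finiteRankAdj :=
  AddSubgroup.subset_closure (Set.mem_range_self (p, q))

theorem sum_single_apply_eq {s : Finset E} {q : E →₀ F} (h : q.support ⊆ s) :
    ∑ e ∈ s, Finsupp.single e (1 * q e) = q := by
  simp_rw [one_mul]
  rw [← Finsupp.sum_of_support_subset q h (fun e c => Finsupp.single e c) (by simp),
    Finsupp.sum_single]

/-- Sum the coordinate projections over all edges in the supports of the given finite sets. -/
theorem system_FS : (G.system F).FS := by
  classical
  intro s t
  refine ⟨∑ e ∈ s.biUnion Finsupp.support,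
      (G.system F).theta (Finsupp.single e 1) (Finsupp.single e 1),
    sum_mem fun e _ => G.theta_mem_finiteRank F _ _,
    ∑ e ∈ t.biUnion Finsupp.support,
      (G.system F).thetaAdj (Finsupp.single e 1) (Finsupp.single e 1),
    sum_mem fun e _ => G.thetaAdj_mem_finiteRankAdj F _ _, fun q hq => ?_, fun p hp => ?_⟩
  · simp only [AddMonoidHom.finsetSum_apply, theta_single]
    exact sum_single_apply_eq F (Finset.subset_biUnion_of_mem Finsupp.support hq)
  · simp only [AddMonoidHom.finsetSum_apply, thetaAdj_single]
    exact sum_single_apply_eq F (Finset.subset_biUnion_of_mem Finsupp.support hp)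

/-- A finite rank map takes its values in the span of finitely many edges. -/
theorem exists_finset_of_mem_finiteRank {Θ : (E →₀ F) →+ (E →₀ F)}
    (h : Θ ∈ (G.system F).finiteRank) : ∃ s : Finset E, ∀ x, ∀ e ∉ s, Θ x e = 0 := by
  classical
  refine AddSubgroup.closure_induction (p := fun Θ _ =>
    ∃ s : Finset E, ∀ x, ∀ e ∉ s, Θ x e = 0) ?_ ⟨∅, by simp⟩ ?_ ?_ h
  · rintro _ ⟨⟨q, p⟩, rfl⟩
    refine ⟨q.support, fun x e he => ?_⟩
    rw [theta_apply, Finsupp.notMem_support_iff.1 he, mul_zero]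
  · rintro Θ₁ Θ₂ _ _ ⟨s, hs⟩ ⟨t, ht⟩
    refine ⟨s ∪ t, fun x e he => ?_⟩
    rw [Finset.notMem_union] at he
    simp [hs x e he.1, ht x e he.2]
  · rintro Θ _ ⟨s, hs⟩
    exact ⟨s, fun x e he => by simp [hs x e he]⟩

/-- Both sides scale by $c$ the coordinates at edges leaving $v$ and kill the others; finiteness
makes this a finite sum of rank-one maps. -/
theorem Delta_single {v : V} (hv : {e | G.s e = v}.Finite) (c : F) :
    (G.system F).Delta (Finsupp.single v c) =
      ∑ e ∈ hv.toFinset, (G.system F).theta (Finsupp.single e c) (Finsupp.single e 1) := by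
  classical
  refine AddMonoidHom.ext fun x => Finsupp.ext fun f => ?_
  simp only [AddMonoidHom.finsetSum_apply, theta_single, Delta_apply, Finsupp.finsetSum_apply,
    Finsupp.single_apply, Finset.sum_ite_eq', Set.Finite.mem_toFinset, Set.mem_ofPred_eq, ite_mul,
    zero_mul, eq_comm (a := v)]

theorem Delta_mem_finiteRank_iff {a : V →₀ F} :
    (G.system F).Delta a ∈ (G.system F).finiteRank ↔
      ∀ v, a v ≠ 0 → {e | G.s e = v}.Finite := by
  constructor
  · intro h v hv
    obtain ⟨s, hs⟩ := G.exists_finset_of_mem_finiteRank F h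
    refine s.finite_toSet.subset fun e he => ?_
    by_contra hes
    -- Testing on $\mathbf 1_e$ recovers the coefficient $a_{s(e)}$, which would have to vanish for
    -- $e$ outside the finite set.
    have h1 := hs (Finsupp.single e 1) e hes
    rw [Delta_apply, Finsupp.single_eq_same, mul_one] at h1
    exact hv (he ▸ h1)
  · intro h
    have h1 : (G.system F).Delta a =
        ∑ v ∈ a.support, (G.system F).Delta (Finsupp.single v (a v)) := by
      conv_lhs => rw [← Finsupp.sum_single a]
      exact map_finsuppSum (G.system F).bimodQ.left a _
    rw [h1]
    refine sum_mem fun v hv => ?_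
    rw [G.Delta_single F (h v (Finsupp.mem_support_iff.1 hv))]
    exact sum_mem fun e _ => G.theta_mem_finiteRank F _ _

theorem perp_ker_Delta_iff {a : V →₀ F} :
    (∀ b, (G.system F).Delta b = 0 → a * b = 0 ∧ b * a = 0) ↔
      ∀ v, a v ≠ 0 → {e | G.s e = v}.Nonempty := by
  constructor
  · intro h v hv
    by_contra hne
    refine hv ?_
    -- A vertex emitting no edge lies in $\ker\Delta$, so it can be used to test orthogonality:
    -- $a\mathbf 1_v=0$ forces $a_v=0$.
    have hker : (G.system F).Delta (Finsupp.single v 1) = 0 := by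
      rw [Delta_eq_zero_iff]
      intro e
      refine Finsupp.single_eq_of_ne' ?_
      rintro rfl
      exact hne ⟨e, rfl⟩
    have h1 := DFunLike.congr_fun (h _ hker).1 v
    simpa using h1
  · intro h b hb
    rw [Delta_eq_zero_iff] at hb
    have hab : a * b = 0 := by
      ext v
      by_cases hv : a v = 0
      · simp [hv]
      · obtain ⟨e, rfl⟩ := h v hv
        simp [hb e]
    exact ⟨hab, by rw [mul_comm, hab]⟩

/-- The ideal `span_F {1_v : 0 < |s⁻¹(v)| < ∞}`. -/
noncomputable def regularIdeal : TwoSidedIdeal (V →₀ F) :=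
  TwoSidedIdeal.mk' (G.vertexSpan F {v | {e | G.s e = v}.Nonempty ∧ {e | G.s e = v}.Finite})
    (zero_mem _) (fun h₁ h₂ => add_mem h₁ h₂) (fun h => neg_mem h)
    (fun {x y} h => (G.mem_vertexSpan_iff F).2 fun v hv =>
      (G.mem_vertexSpan_iff F).1 h v fun h0 => hv (by simp [h0]))
    (fun {x y} h => (G.mem_vertexSpan_iff F).2 fun v hv =>
      (G.mem_vertexSpan_iff F).1 h v fun h0 => hv (by simp [h0]))

theorem coe_regularIdeal : (G.regularIdeal F : Set (V →₀ F)) =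
    G.vertexSpan F {v | {e | G.s e = v}.Nonempty ∧ {e | G.s e = v}.Finite} := by
  simp [regularIdeal]

theorem mem_regularIdeal_iff {a : V →₀ F} : a ∈ G.regularIdeal F ↔
    ∀ v, a v ≠ 0 → {e | G.s e = v}.Nonempty ∧ {e | G.s e = v}.Finite := by
  rw [← SetLike.mem_coe, coe_regularIdeal, SetLike.mem_coe, mem_vertexSpan_iff]
  rfl

theorem isUniquelyMaximal_regularIdeal : (G.system F).IsUniquelyMaximal (G.regularIdeal F) where
  compatible x hx := (G.Delta_mem_finiteRank_iff F).2 fun v hv =>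
    ((G.mem_regularIdeal_iff F).1 hx v hv).2
  faithful x hx h0 := by
    ext v
    by_contra hv
    obtain ⟨e, rfl⟩ := ((G.mem_regularIdeal_iff F).1 hx v hv).1
    exact hv ((G.Delta_eq_zero_iff F).1 h0 e)
  le_of J hJ hJf x hx := by
    refine (G.mem_regularIdeal_iff F).2 fun v hv =>
      ⟨?_, (G.Delta_mem_finiteRank_iff F).1 (hJ x hx) v hv⟩
    by_contra hne
    -- Multiplication by $\mathbf 1_v$ isolates one coordinate inside the ideal. If $v$ emitted no
    -- edge, this element would lie in $\ker\Delta$, against faithfulness.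
    have h1 : Finsupp.single v (x v) ∈ J := by
      have h2 := J.mul_mem_right x (Finsupp.single v 1) hx
      rwa [mul_single_eq, mul_one] at h2
    have h3 := hJf _ h1 <| (G.Delta_eq_zero_iff F).2 fun e => by
      refine Finsupp.single_eq_of_ne' ?_
      rintro rfl
      exact hne ⟨e, rfl⟩
    exact hv (Finsupp.single_eq_zero.1 h3)

end OrientedGraph

/-! ### Universal property of the relative Cuntz–Pimsner rings -/

namespace RSystem

variable {R P Q : Type*} [NonUnitalRing R] [AddCommGroup P] [AddCommGroup Q]
variable (X : RSystem R P Q)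

theorem toToeplitz_surjective : Function.Surjective X.toToeplitz := by
  rintro ⟨x⟩
  exact ⟨x, rfl⟩

/-- The Toeplitz ring is generated by the images of `R`, `P` and `Q`. -/
theorem toeplitz_induction {p : X.Toeplitz → Prop} (hσ : ∀ r, p (X.toeplitzRep.σ r))
    (hS : ∀ y, p (X.toeplitzRep.S y)) (hT : ∀ q, p (X.toeplitzRep.T q))
    (hadd : ∀ x y, p x → p y → p (x + y)) (hneg : ∀ x, p x → p (-x))
    (hmul : ∀ x y, p x → p y → p (x * y)) (x : X.Toeplitz) : p x := by
  have h0 : p 0 := by simpa using hσ 0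
  obtain ⟨x, rfl⟩ := X.toToeplitz_surjective x
  induction x using MonoidAlgebra.induction_linear with
  | zero => simpa using h0
  | add x y hx hy => rw [map_add]; exact hadd _ _ hx hy
  | single w n =>
    have hw : p (X.toToeplitz (MonoidAlgebra.single w 1)) := by
      induction w using FreeSemigroup.recOnMul with
      | ih1 x =>
        rcases x with r | y | q
        · exact hσ r
        · exact hS y
        · exact hT q
      | ih2 x y hx hy =>
        have hs : (MonoidAlgebra.single (FreeSemigroup.of x * y) 1 : X.FreeRng) =
            MonoidAlgebra.single (FreeSemigroup.of x) 1 * MonoidAlgebra.single y 1 := by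
          simp
        rw [hs, map_mul]
        exact hmul _ _ hx hy
    have hn : (MonoidAlgebra.single w n : X.FreeRng) = n • MonoidAlgebra.single w 1 := by
      simp
    rw [hn, map_zsmul]
    -- Integer coefficients are reached by repeated addition and a sign, since `p` is closed only
    -- under ring operations.
    have hnat : ∀ k : ℕ, p (k • X.toToeplitz (MonoidAlgebra.single w 1)) := by
      intro k
      induction k with
      | zero => simpa using h0
      | succ k ih => rw [succ_nsmul]; exact hadd _ _ ih hw
    obtain ⟨k, rfl | rfl⟩ := n.eq_nat_or_neg
    · simpa using hnat k
    · simpa using hneg _ (hnat k)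

variable {X}

/-- A homomorphism which intertwines covariant representations intertwines the maps `π`. -/
theorem map_pi (hX : X.FS) {B C : Type*} [NonUnitalRing B] [NonUnitalRing C]
    (ρ : CovariantRep X B) (τ : CovariantRep X C) (η : B →ₙ+* C)
    (hT : ∀ q, η (ρ.T q) = τ.T q) (hS : ∀ p, η (ρ.S p) = τ.S p) (Θ : X.finiteRank) :
    η (ρ.pi hX Θ) = τ.pi hX Θ := by
  obtain ⟨t, rfl⟩ := CovariantRep.thetaSum_surjective X Θ
  induction t using FreeAbelianGroup.induction_on with
  | zero => simp
  | of x =>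
    have hmem : X.theta x.1 x.2 ∈ X.finiteRank :=
      AddSubgroup.subset_closure (Set.mem_range_self x)
    have h : CovariantRep.thetaSum X (FreeAbelianGroup.of x) = ⟨X.theta x.1 x.2, hmem⟩ := by
      simp [CovariantRep.thetaSum]
    rw [h, CovariantRep.pi_theta, CovariantRep.pi_theta, map_mul, hT, hS]
  | neg x h => simp only [map_neg, h]
  | add x y hx hy => simp only [map_add, hx, hy]

section

variable (hX : X.FS) (J : TwoSidedIdeal R) (hJ : X.IsPsiCompatible J)

theorem toRelCuntzPimsner_surjective : Function.Surjective (toRelCuntzPimsner hX J hJ) := by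
  rintro ⟨x⟩
  exact ⟨x, rfl⟩

/-- Generation passes from the Toeplitz ring to its quotient. No scalar clause is needed, because
all of $R$, $P$, $Q$ serve as generators; so the principle is available before any $F$-structure
exists. -/
theorem relCuntzPimsner_induction {p : RelCuntzPimsner hX J hJ → Prop}
    (hσ : ∀ r, p ((cuntzPimsnerRep hX J hJ).σ r)) (hS : ∀ y, p ((cuntzPimsnerRep hX J hJ).S y))
    (hT : ∀ q, p ((cuntzPimsnerRep hX J hJ).T q)) (hadd : ∀ x y, p x → p y → p (x + y))
    (hneg : ∀ x, p x → p (-x)) (hmul : ∀ x y, p x → p y → p (x * y))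
    (x : RelCuntzPimsner hX J hJ) : p x := by
  obtain ⟨x, rfl⟩ := toRelCuntzPimsner_surjective hX J hJ x
  induction x using X.toeplitz_induction with
  | hσ r => exact hσ r
  | hS y => exact hS y
  | hT q => exact hT q
  | hadd x y hx hy => rw [map_add]; exact hadd _ _ hx hy
  | hneg x hx => rw [map_neg]; exact hneg _ hx
  | hmul x y hx hy => rw [map_mul]; exact hmul _ _ hx hy

/-- The Cuntz–Pimsner representation relative to `J` is Cuntz–Pimsner invariant relative to
`J`. -/
theorem cuntzPimsnerRep_σ_eq_pi (x : R) (hx : x ∈ J) : (cuntzPimsnerRep hX J hJ).σ x =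
    (cuntzPimsnerRep hX J hJ).pi hX ⟨X.Delta x, hJ x hx⟩ := by
  -- Once $\pi$ is pulled back to the Toeplitz ring, the difference of the two sides is the image of
  -- a generator of the ideal.
  rw [← map_pi hX X.toeplitzRep (cuntzPimsnerRep hX J hJ) (toRelCuntzPimsner hX J hJ)
    (fun _ => rfl) (fun _ => rfl)]
  refine (RingCon.eq _).2 (((toeplitzIdeal hX J hJ).rel_iff _ _).2 ?_)
  exact TwoSidedIdeal.subset_span (Set.mem_range_self (⟨x, hx⟩ : {x : R // x ∈ J}))

/-- The universal property of the relative Cuntz–Pimsner ring. -/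
theorem exists_relCuntzPimsner_lift {B : Type*} [NonUnitalRing B] (ρ : CovariantRep X B)
    (hρ : ∀ x (hx : x ∈ J), ρ.σ x = ρ.pi hX ⟨X.Delta x, hJ x hx⟩) :
    ∃ η : RelCuntzPimsner hX J hJ →ₙ+* B, (∀ r, η ((cuntzPimsnerRep hX J hJ).σ r) = ρ.σ r) ∧
      (∀ q, η ((cuntzPimsnerRep hX J hJ).T q) = ρ.T q) ∧
      ∀ p, η ((cuntzPimsnerRep hX J hJ).S p) = ρ.S p := by
  obtain ⟨η, ⟨hσ, hT, hS⟩, -⟩ := X.existsUnique_toeplitz_lift ρ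
  have hle : toeplitzIdeal hX J hJ ≤ TwoSidedIdeal.ker η := by
    refine TwoSidedIdeal.span_le.2 ?_
    rintro _ ⟨⟨x, hx⟩, rfl⟩
    rw [SetLike.mem_coe, TwoSidedIdeal.mem_ker, map_sub, hσ, map_pi hX _ ρ η hT hS, hρ x hx,
      sub_self]
  have hker : ∀ x y, (toeplitzIdeal hX J hJ).ringCon x y → η x = η y := by
    intro x y h
    have h1 := hle (((toeplitzIdeal hX J hJ).rel_iff x y).1 h)
    rwa [TwoSidedIdeal.mem_ker, map_sub, sub_eq_zero] at h1
  exact ⟨{ toFun := fun x => Quotient.liftOn' x η hker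
           map_mul' := by rintro ⟨x⟩ ⟨y⟩; exact map_mul η x y
           map_zero' := map_zero η
           map_add' := by rintro ⟨x⟩ ⟨y⟩; exact map_add η x y }, hσ, hT, hS⟩

end

end RSystem

namespace OrientedGraph

variable {V E : Type*} (G : OrientedGraph V E) (F : Type*) [CommRing F]

/-! ### Leavitt families -/

theorem toLeavitt_eq {x y : G.LeavittFree F} (h : G.LeavittRel F x y) :
    G.toLeavitt F x = G.toLeavitt F y :=
  (RingCon.eq _).2 (RingConGen.Rel.of _ _ h)

/-- Elements `p v`, `x e`, `y e` of a ring which satisfy the defining relations of the Leavitt path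
algebra. -/
structure IsLeavittFamily {B : Type*} [NonUnitalRing B] (p : V → B) (x y : E → B) : Prop where
  vertex_self : ∀ v, p v * p v = p v
  vertex_ne : ∀ v w, v ≠ w → p v * p w = 0
  source_edge : ∀ e, p (G.s e) * x e = x e
  edge_range : ∀ e, x e * p (G.r e) = x e
  range_ghost : ∀ e, p (G.r e) * y e = y e
  ghost_source : ∀ e, y e * p (G.s e) = y e
  ghost_edge_self : ∀ e, y e * x e = p (G.r e)
  ghost_edge_ne : ∀ e f, e ≠ f → y e * x f = 0
  vertex_sum : ∀ v (hfin : {e | G.s e = v}.Finite), {e | G.s e = v}.Nonempty →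
    p v = ∑ e ∈ hfin.toFinset, x e * y e

theorem isLeavittFamily_leavitt : G.IsLeavittFamily (G.pv F) (G.xe F) (G.ye F) where
  vertex_self v := by simpa using! G.toLeavitt_eq F (.vertex_self v)
  vertex_ne v w h := by simpa using! G.toLeavitt_eq F (.vertex_ne v w h)
  source_edge e := by simpa using! G.toLeavitt_eq F (.source_edge e)
  edge_range e := by simpa using! G.toLeavitt_eq F (.edge_range e)
  range_ghost e := by simpa using! G.toLeavitt_eq F (.range_ghost e)
  ghost_source e := by simpa using! G.toLeavitt_eq F (.ghost_source e)
  ghost_edge_self e := by simpa using! G.toLeavitt_eq F (.ghost_edge_self e)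
  ghost_edge_ne e f h := by simpa using! G.toLeavitt_eq F (.ghost_edge_ne e f h)
  vertex_sum v hfin hne := by simpa using! G.toLeavitt_eq F (.vertex_sum v hfin hne)

/-- The Leavitt path algebra is generated by the `p_v`, `x_e` and `y_e`. -/
theorem leavitt_induction {p : G.Leavitt F → Prop} (hpv : ∀ v, p (G.pv F v))
    (hxe : ∀ e, p (G.xe F e)) (hye : ∀ e, p (G.ye F e)) (hzero : p 0)
    (hadd : ∀ x y, p x → p y → p (x + y)) (hsmul : ∀ (c : F) x, p x → p (c • x))
    (hmul : ∀ x y, p x → p y → p (x * y)) (x : G.Leavitt F) : p x := by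
  obtain ⟨x, rfl⟩ := G.toLeavitt_surjective F x
  induction x using MonoidAlgebra.induction_linear with
  | zero => simpa using hzero
  | add x y hx hy => rw [map_add]; exact hadd _ _ hx hy
  | single w c =>
    have hw : p (G.toLeavitt F (MonoidAlgebra.single w 1)) := by
      induction w using FreeSemigroup.recOnMul with
      | ih1 x =>
        rcases x with v | e | e
        · exact hpv v
        · exact hxe e
        · exact hye e
      | ih2 x y hx hy =>
        have hs : (MonoidAlgebra.single (FreeSemigroup.of x * y) 1 : G.LeavittFree F) =
            MonoidAlgebra.single (FreeSemigroup.of x) 1 * MonoidAlgebra.single y 1 := by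
          simp
        rw [hs, map_mul]
        exact hmul _ _ hx hy
    have hc : (MonoidAlgebra.single w c : G.LeavittFree F) = c • MonoidAlgebra.single w 1 := by
      simp
    rw [hc, toLeavitt_smul]
    exact hsmul c _ hw

/-- The universal property of the Leavitt path algebra. -/
theorem exists_leavitt_lift {B : Type*} [NonUnitalRing B] [Module F B] [IsScalarTower F B B]
    [SMulCommClass F B B] {p : V → B} {x y : E → B} (h : G.IsLeavittFamily p x y) :
    ∃ η : G.Leavitt F →ₙ+* B, (∀ (c : F) z, η (c • z) = c • η z) ∧ (∀ v, η (G.pv F v) = p v) ∧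
      (∀ e, η (G.xe F e) = x e) ∧ ∀ e, η (G.ye F e) = y e := by
  let g : LeavittGen V E → B := fun z => LeavittGen.casesOn z p x y
  let f : G.LeavittFree F →ₙₐ[F] B := MonoidAlgebra.liftMagma F (FreeSemigroup.lift g)
  have hf : ∀ z, f (G.lgen z) = g z := by
    intro z; simp [f, lgen]
  have hp : ∀ v, f (G.lgen (.vertex v)) = p v := fun v => hf _
  have hx : ∀ e, f (G.lgen (.edge e)) = x e := fun e => hf _
  have hy : ∀ e, f (G.lgen (.ghost e)) = y e := fun e => hf _
  have hrel : ∀ z w, G.LeavittRel F z w → f z = f w := by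
    intro z w hzw
    induction hzw with
    | vertex_self v => simp only [map_mul, hp, h.vertex_self]
    | vertex_ne v w hvw => simp only [map_mul, map_zero, hp, h.vertex_ne v w hvw]
    | source_edge e => simp only [map_mul, hp, hx, h.source_edge]
    | edge_range e => simp only [map_mul, hp, hx, h.edge_range]
    | range_ghost e => simp only [map_mul, hp, hy, h.range_ghost]
    | ghost_source e => simp only [map_mul, hp, hy, h.ghost_source]
    | ghost_edge_self e => simp only [map_mul, hp, hx, hy, h.ghost_edge_self]
    | ghost_edge_ne e e' hne => simp only [map_mul, map_zero, hx, hy, h.ghost_edge_ne e e' hne]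
    | vertex_sum v hfin hne => simp only [map_sum, map_mul, hp, hx, hy, h.vertex_sum v hfin hne]
    -- The scalar closure built into the relations is harmless because `f` is $F$-linear.
    | smul c z w _ ih => rw [map_smul, map_smul, ih]
  have hker : ∀ z w, G.leavittCon F z w → f z = f w := by
    intro z w hzw
    change RingConGen.Rel _ z w at hzw
    induction hzw with
    | of z w hzw => exact hrel z w hzw
    | refl z => rfl
    | symm _ ih => exact ih.symm
    | trans _ _ ih₁ ih₂ => exact ih₁.trans ih₂
    | add _ _ ih₁ ih₂ => rw [map_add, map_add, ih₁, ih₂]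
    | mul _ _ ih₁ ih₂ => rw [map_mul, map_mul, ih₁, ih₂]
  refine ⟨{ toFun := fun z => Quotient.liftOn' z f hker
            map_mul' := by rintro ⟨z⟩ ⟨w⟩; exact map_mul f z w
            map_zero' := map_zero f
            map_add' := by rintro ⟨z⟩ ⟨w⟩; exact map_add f z w }, ?_, hp, hx, hy⟩
  rintro c ⟨z⟩
  exact map_smul f c z

end OrientedGraph

namespace OrientedGraph

variable {V E : Type*} (G : OrientedGraph V E) (F : Type*) [CommRing F]

/-! ### The representation of the system of a graph on the Leavitt path algebra -/

theorem actAlong_single {E V : Type*} (f : E → V) (a : V →₀ F) (e : E) (d : F) :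
    actAlong f a (Finsupp.single e d) = Finsupp.single e (a (f e) * d) := by
  ext e'
  by_cases h : e = e'
  · subst h; simp
  · simp [Finsupp.single_eq_of_ne' h]

/-- Reduces biadditive identities, such as the covariance axioms, to pairs of scaled basis vectors.
-/
theorem finsupp_induction₂ {α β : Type*} {p : (α →₀ F) → (β →₀ F) → Prop}
    (zero_left : ∀ b, p 0 b) (zero_right : ∀ a, p a 0)
    (add_left : ∀ a a' b, p a b → p a' b → p (a + a') b)
    (add_right : ∀ a b b', p a b → p a b' → p a (b + b'))
    (single : ∀ i c j d, p (Finsupp.single i c) (Finsupp.single j d)) (a : α →₀ F)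
    (b : β →₀ F) : p a b := by
  induction a using Finsupp.induction_linear with
  | zero => exact zero_left b
  | add a a' h h' => exact add_left _ _ _ h h'
  | single i c =>
    induction b using Finsupp.induction_linear with
    | zero => exact zero_right _
    | add b b' h h' => exact add_right _ _ _ h h'
    | single j d => exact single i c j d

section

variable {G F}

theorem left_Q_eq (a : V →₀ F) (q : E →₀ F) :
    (G.system F).bimodQ.left a q = actAlong G.s a q := rfl

theorem right_Q_eq (a : V →₀ F) (q : E →₀ F) :
    (G.system F).bimodQ.right q a = actAlong G.r a q := rfl

theorem left_P_eq (a : V →₀ F) (q : E →₀ F) :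
    (G.system F).bimodP.left a q = actAlong G.r a q := rfl

theorem right_P_eq (a : V →₀ F) (q : E →₀ F) :
    (G.system F).bimodP.right q a = actAlong G.s a q := rfl

/-- Leaving the Kronecker delta as an evaluation of `Finsupp.single f d` at `e` covers equal and
distinct edges together. -/
theorem psi_single (e f : E) (c d : F) :
    (G.system F).psi (Finsupp.single e c) (Finsupp.single f d) =
      Finsupp.single (G.r e) (c * Finsupp.single f d e) := by
  change (Finsupp.single e c * Finsupp.single f d).mapDomain G.r = _
  rw [single_mul_eq, Finsupp.mapDomain_single]

end

section

variable {G} {B : Type*} [NonUnitalRing B] {p : V → B} {x y : E → B}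

/-- Insert the endpoint idempotent that absorbs the edge and use orthogonality of vertices. The next
three lemmas are the other sides of edges and ghost edges. -/
theorem IsLeavittFamily.vertex_mul_edge_ne (h : G.IsLeavittFamily p x y) {v : V} {e : E}
    (hv : v ≠ G.s e) : p v * x e = 0 := by
  rw [← h.source_edge, ← mul_assoc, h.vertex_ne _ _ hv, zero_mul]

theorem IsLeavittFamily.edge_mul_vertex_ne (h : G.IsLeavittFamily p x y) {v : V} {e : E}
    (hv : G.r e ≠ v) : x e * p v = 0 := by
  rw [← h.edge_range, mul_assoc, h.vertex_ne _ _ hv, mul_zero]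

theorem IsLeavittFamily.vertex_mul_ghost_ne (h : G.IsLeavittFamily p x y) {v : V} {e : E}
    (hv : v ≠ G.r e) : p v * y e = 0 := by
  rw [← h.range_ghost, ← mul_assoc, h.vertex_ne _ _ hv, zero_mul]

theorem IsLeavittFamily.ghost_mul_vertex_ne (h : G.IsLeavittFamily p x y) {v : V} {e : E}
    (hv : G.s e ≠ v) : y e * p v = 0 := by
  rw [← h.ghost_source, mul_assoc, h.vertex_ne _ _ hv, mul_zero]

variable [Module F B] [IsScalarTower F B B] [SMulCommClass F B B]

/-- The ring homomorphism `∑ a_v 1_v ↦ ∑ a_v p_v` given by a Leavitt family. -/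
noncomputable def IsLeavittFamily.vertexHom (h : G.IsLeavittFamily p x y) : (V →₀ F) →ₙ+* B :=
  { (Finsupp.linearCombination F p).toAddMonoidHom with
    map_mul' := by
      refine finsupp_induction₂ F ?_ ?_ ?_ ?_ ?_
      · simp
      · simp
      · intro a a' b h₁ h₂
        simp_all [add_mul]
      · intro a b b' h₁ h₂
        simp_all [mul_add]
      · intro v c w d
        rw [single_mul_eq]
        by_cases hvw : v = w
        · subst hvw
          simp [-Finsupp.single_mul, smul_mul_smul_comm, h.vertex_self]
        · simp [smul_mul_smul_comm, h.vertex_ne v w hvw, Finsupp.single_eq_of_ne hvw] }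

theorem IsLeavittFamily.vertexHom_apply (h : G.IsLeavittFamily p x y) (a : V →₀ F) :
    h.vertexHom F a = Finsupp.linearCombination F p a := rfl

/-- The covariant representation of the system of a graph given by a Leavitt family. -/
noncomputable def IsLeavittFamily.rep (h : G.IsLeavittFamily p x y) :
    CovariantRep (G.system F) B where
  S := (Finsupp.linearCombination F y).toAddMonoidHom
  T := (Finsupp.linearCombination F x).toAddMonoidHom
  σ := h.vertexHom F
  S_right := by
    refine finsupp_induction₂ F (by simp) (by simp) ?_ ?_ ?_
    · intro a a' b h₁ h₂
      simp_all [add_mul]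
    · intro a b b' h₁ h₂
      simp_all [mul_add]
    · intro e c v d
      rw [right_P_eq, actAlong_single]
      by_cases hv : G.s e = v
      · subst hv
        simp [-Finsupp.single_mul, h.vertexHom_apply F, smul_mul_smul_comm, h.ghost_source, mul_comm]
      · simp [h.vertexHom_apply F, smul_mul_smul_comm, h.ghost_mul_vertex_ne hv, Finsupp.single_eq_of_ne hv]
  S_left := by
    refine finsupp_induction₂ F (by simp) (by simp) ?_ ?_ ?_
    · intro a a' b h₁ h₂
      simp_all [add_mul]
    · intro a b b' h₁ h₂
      simp_all [mul_add]
    · intro v c e d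
      rw [left_P_eq, actAlong_single]
      by_cases hv : v = G.r e
      · subst hv
        simp [-Finsupp.single_mul, h.vertexHom_apply F, smul_mul_smul_comm, h.range_ghost]
      · simp [h.vertexHom_apply F, smul_mul_smul_comm, h.vertex_mul_ghost_ne hv, Finsupp.single_eq_of_ne' hv]
  T_right := by
    refine finsupp_induction₂ F (by simp) (by simp) ?_ ?_ ?_
    · intro a a' b h₁ h₂
      simp_all [add_mul]
    · intro a b b' h₁ h₂
      simp_all [mul_add]
    · intro e c v d
      rw [right_Q_eq, actAlong_single]
      by_cases hv : G.r e = v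
      · subst hv
        simp [-Finsupp.single_mul, h.vertexHom_apply F, smul_mul_smul_comm, h.edge_range, mul_comm]
      · simp [h.vertexHom_apply F, smul_mul_smul_comm, h.edge_mul_vertex_ne hv, Finsupp.single_eq_of_ne hv]
  T_left := by
    refine finsupp_induction₂ F (by simp) (by simp) ?_ ?_ ?_
    · intro a a' b h₁ h₂
      simp_all [add_mul]
    · intro a b b' h₁ h₂
      simp_all [mul_add]
    · intro v c e d
      rw [left_Q_eq, actAlong_single]
      by_cases hv : v = G.s e
      · subst hv
        simp [-Finsupp.single_mul, h.vertexHom_apply F, smul_mul_smul_comm, h.source_edge]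
      · simp [h.vertexHom_apply F, smul_mul_smul_comm, h.vertex_mul_edge_ne hv, Finsupp.single_eq_of_ne' hv]
  σ_psi := by
    refine finsupp_induction₂ F (by simp) (by simp) ?_ ?_ ?_
    · intro a a' b h₁ h₂
      simp_all [add_mul]
    · intro a b b' h₁ h₂
      simp_all [mul_add]
    · intro e c f d
      rw [psi_single]
      by_cases hef : e = f
      · subst hef
        simp [-Finsupp.single_mul, h.vertexHom_apply F, smul_mul_smul_comm, h.ghost_edge_self]
      · simp [smul_mul_smul_comm, h.ghost_edge_ne e f hef, Finsupp.single_eq_of_ne hef]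

theorem IsLeavittFamily.rep_σ (h : G.IsLeavittFamily p x y) (a : V →₀ F) :
    (h.rep F).σ a = Finsupp.linearCombination F p a := rfl

theorem IsLeavittFamily.rep_T (h : G.IsLeavittFamily p x y) (q : E →₀ F) :
    (h.rep F).T q = Finsupp.linearCombination F x q := rfl

theorem IsLeavittFamily.rep_S (h : G.IsLeavittFamily p x y) (q : E →₀ F) :
    (h.rep F).S q = Finsupp.linearCombination F y q := rfl

end

/-! ### Covariant representations of the system of a graph -/

section

variable {G F} {B : Type*} [NonUnitalRing B] (ρ : CovariantRep (G.system F) B)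

theorem pi_Delta_single (hX : (G.system F).FS) {v : V} (hv : {e | G.s e = v}.Finite) (c : F)
    (hmem : (G.system F).Delta (Finsupp.single v c) ∈ (G.system F).finiteRank) :
    ρ.pi hX ⟨(G.system F).Delta (Finsupp.single v c), hmem⟩ =
      ∑ e ∈ hv.toFinset, ρ.T (Finsupp.single e c) * ρ.S (Finsupp.single e 1) := by
  have h : (⟨(G.system F).Delta (Finsupp.single v c), hmem⟩ : (G.system F).finiteRank) =
      ∑ e ∈ hv.toFinset, ⟨(G.system F).theta (Finsupp.single e c) (Finsupp.single e 1),
        G.theta_mem_finiteRank F _ _⟩ := by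
    refine Subtype.ext ?_
    rw [AddSubgroup.val_finsetSum]
    exact G.Delta_single F hv c
  rw [h, map_sum]
  exact Finset.sum_congr rfl fun e _ => CovariantRep.pi_theta hX ρ _ _ _

/-- Cuntz–Pimsner invariance can be checked on the elements `c 1_v`. -/
theorem σ_eq_pi_of_single (hX : (G.system F).FS)
    (h : ∀ v (c : F) (hfin : {e | G.s e = v}.Finite), {e | G.s e = v}.Nonempty →
      ρ.σ (Finsupp.single v c) =
        ∑ e ∈ hfin.toFinset, ρ.T (Finsupp.single e c) * ρ.S (Finsupp.single e 1))
    (a : V →₀ F) (ha : a ∈ G.regularIdeal F)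
    (hmem : (G.system F).Delta a ∈ (G.system F).finiteRank) :
    ρ.σ a = ρ.pi hX ⟨(G.system F).Delta a, hmem⟩ := by
  have hreg := (G.mem_regularIdeal_iff F).1 ha
  have hs : ∀ v ∈ a.support,
      (G.system F).Delta (Finsupp.single v (a v)) ∈ (G.system F).finiteRank := by
    intro v hv
    rw [G.Delta_single F (hreg v (Finsupp.mem_support_iff.1 hv)).2]
    exact sum_mem fun e _ => G.theta_mem_finiteRank F _ _
  -- The map $\pi$ lives on the subgroup of finite rank maps, so each summand must carry a
  -- membership proof; summing over the attached support supplies it.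
  have hsum : (⟨(G.system F).Delta a, hmem⟩ : (G.system F).finiteRank) =
      ∑ v ∈ a.support.attach,
        ⟨(G.system F).Delta (Finsupp.single v.1 (a v)), hs v.1 v.2⟩ := by
    refine Subtype.ext ?_
    rw [AddSubgroup.val_finsetSum]
    change (G.system F).Delta a =
      ∑ v ∈ a.support.attach, (G.system F).Delta (Finsupp.single v.1 (a v))
    rw [Finset.sum_attach a.support fun v => (G.system F).Delta (Finsupp.single v (a v))]
    conv_lhs => rw [← Finsupp.sum_single a]
    exact map_finsuppSum (G.system F).bimodQ.left a _
  rw [hsum, map_sum]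
  conv_lhs => rw [← Finsupp.sum_single a, map_finsuppSum, Finsupp.sum, ← Finset.sum_attach]
  refine Finset.sum_congr rfl fun v _ => ?_
  obtain ⟨hne, hfin⟩ := hreg v.1 (Finsupp.mem_support_iff.1 v.2)
  rw [h _ _ hfin hne, pi_Delta_single ρ hX hfin]

/-- A Cuntz–Pimsner invariant covariant representation gives a Leavitt family. -/
theorem isLeavittFamily_of_rep (hX : (G.system F).FS)
    (hρ : ∀ a (ha : a ∈ G.regularIdeal F), ρ.σ a = ρ.pi hX
      ⟨(G.system F).Delta a, (G.isUniquelyMaximal_regularIdeal F).compatible a ha⟩) :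
    G.IsLeavittFamily (fun v => ρ.σ (Finsupp.single v 1)) (fun e => ρ.T (Finsupp.single e 1))
      (fun e => ρ.S (Finsupp.single e 1)) where
  vertex_self v := by rw [← map_mul, single_mul_eq]; simp [-Finsupp.single_mul]
  vertex_ne v w h := by rw [← map_mul, single_mul_eq]; simp [Finsupp.single_eq_of_ne h]
  source_edge e := by rw [← ρ.T_left, left_Q_eq]; simp [actAlong_single]
  edge_range e := by rw [← ρ.T_right, right_Q_eq]; simp [actAlong_single]
  range_ghost e := by rw [← ρ.S_left, left_P_eq]; simp [actAlong_single]
  ghost_source e := by rw [← ρ.S_right, right_P_eq]; simp [actAlong_single]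
  ghost_edge_self e := by rw [← ρ.σ_psi, psi_single]; simp
  ghost_edge_ne e f h := by rw [← ρ.σ_psi, psi_single]; simp [Finsupp.single_eq_of_ne h]
  vertex_sum v hfin hne := by
    have hmem : Finsupp.single v (1 : F) ∈ G.regularIdeal F := by
      refine (G.mem_regularIdeal_iff F).2 fun w hw => ?_
      by_cases h : v = w
      · subst h; exact ⟨hne, hfin⟩
      · exact absurd (Finsupp.single_eq_of_ne' h) hw
    rw [hρ _ hmem, pi_Delta_single ρ hX hfin]

/-! ### Scalars on rings generated by a covariant representation -/

/-- `∑_{v ∈ W} c 1_v`. -/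
noncomputable def constOn (W : Finset V) (c : F) : V →₀ F :=
  Finsupp.indicator W fun _ _ => c

theorem constOn_apply_of_mem {W : Finset V} {v : V} (hv : v ∈ W) (c : F) : constOn W c v = c :=
  Finsupp.indicator_of_mem hv _

theorem constOn_apply_of_notMem {W : Finset V} {v : V} (hv : v ∉ W) (c : F) :
    constOn W c v = 0 :=
  Finsupp.indicator_of_notMem hv _

theorem constOn_mul_constOn {W W' : Finset V} (h : W ⊆ W') (c d : F) :
    constOn W' c * constOn W d = constOn W (c * d) := by
  ext v
  by_cases hv : v ∈ W
  · simp [constOn_apply_of_mem hv, constOn_apply_of_mem (h hv)]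
  · simp [constOn_apply_of_notMem hv]

theorem constOn_add (W : Finset V) (c d : F) :
    constOn W (c + d) = constOn W c + constOn W d := by
  ext v
  by_cases hv : v ∈ W
  · simp [constOn_apply_of_mem hv]
  · simp [constOn_apply_of_notMem hv]

theorem smul_constOn (W : Finset V) (c d : F) : c • constOn W d = constOn W (c * d) := by
  ext v
  by_cases hv : v ∈ W
  · simp [constOn_apply_of_mem hv]
  · simp [constOn_apply_of_notMem hv]

/-- Scalar multiplication is realised by multiplication inside $R$, so ring homomorphisms out of $R$
can see it. `actAlong_constOn` is the analogue for edges. -/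
theorem constOn_mul {W : Finset V} {a : V →₀ F} (h : a.support ⊆ W) (c : F) :
    constOn W c * a = c • a := by
  ext v
  by_cases hv : v ∈ W
  · simp [constOn_apply_of_mem hv]
  · simp [Finsupp.notMem_support_iff.1 fun hv' => hv (h hv')]

theorem actAlong_constOn {W : Finset V} {f : E → V} {q : E →₀ F}
    (h : ∀ e ∈ q.support, f e ∈ W) (c : F) : actAlong f (constOn W c) q = c • q := by
  ext e
  by_cases he : e ∈ q.support
  · simp [constOn_apply_of_mem (h e he)]
  · simp [Finsupp.notMem_support_iff.1 he]

/-- The idempotent `σ (∑_{v ∈ W} 1_v)` is a left unit for `x`, and `x` commutes with the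
elements `σ (∑_{v ∈ W'} c 1_v)` with `W ⊆ W'`. -/
def HasLocalUnit (W : Finset V) (x : B) : Prop :=
  ρ.σ (constOn W 1) * x = x ∧
    ∀ W' : Finset V, W ⊆ W' → ∀ c, x * ρ.σ (constOn W' c) = ρ.σ (constOn W' c) * x

namespace HasLocalUnit

variable {ρ}

/-- Replace $x$ by $\sigma(\mathbf 1_W)x$ and use $(c\mathbf 1_{W'})\mathbf 1_W=c\mathbf 1_W$.
Enlarging $W$ thus does not change the candidate for $cx$. -/
theorem σ_mul_eq {W W' : Finset V} {x : B} (h : HasLocalUnit ρ W x) (hW : W ⊆ W') (c : F) :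
    ρ.σ (constOn W' c) * x = ρ.σ (constOn W c) * x := by
  conv_lhs => rw [← h.1]
  rw [← mul_assoc, ← map_mul, constOn_mul_constOn hW, mul_one]

theorem mono {W W' : Finset V} {x : B} (h : HasLocalUnit ρ W x) (hW : W ⊆ W') :
    HasLocalUnit ρ W' x :=
  ⟨by rw [h.σ_mul_eq hW, h.1], fun W'' hW'' => h.2 W'' (hW.trans hW'')⟩

theorem add {W : Finset V} {x y : B} (hx : HasLocalUnit ρ W x) (hy : HasLocalUnit ρ W y) :
    HasLocalUnit ρ W (x + y) :=
  ⟨by rw [mul_add, hx.1, hy.1], fun W' hW' c => by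
    rw [mul_add, add_mul, hx.2 W' hW', hy.2 W' hW']⟩

theorem neg {W : Finset V} {x : B} (hx : HasLocalUnit ρ W x) : HasLocalUnit ρ W (-x) :=
  ⟨by rw [mul_neg, hx.1], fun W' hW' c => by rw [mul_neg, neg_mul, hx.2 W' hW']⟩

theorem mul {W : Finset V} {x y : B} (hx : HasLocalUnit ρ W x) (hy : HasLocalUnit ρ W y) :
    HasLocalUnit ρ W (x * y) :=
  ⟨by rw [← mul_assoc, hx.1], fun W' hW' c => by
    rw [mul_assoc, hy.2 W' hW', ← mul_assoc, hx.2 W' hW', mul_assoc]⟩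

theorem of_σ {W : Finset V} {a : V →₀ F} (h : a.support ⊆ W) : HasLocalUnit ρ W (ρ.σ a) :=
  ⟨by rw [← map_mul, constOn_mul h, one_smul], fun W' hW' c => by
    rw [← map_mul, ← map_mul, mul_comm]⟩

/-- Sources give the left unit; with ranges also in $W$, both $(c\mathbf 1_{W'})q$ and $q(c\mathbf
1_{W'})$ equal $cq$, whence commutation. -/
theorem of_T {W : Finset V} {q : E →₀ F} (hs : ∀ e ∈ q.support, G.s e ∈ W)
    (hr : ∀ e ∈ q.support, G.r e ∈ W) : HasLocalUnit ρ W (ρ.T q) :=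
  ⟨by rw [← ρ.T_left, left_Q_eq, actAlong_constOn hs, one_smul], fun W' hW' c => by
    rw [← ρ.T_left, ← ρ.T_right, left_Q_eq, right_Q_eq,
      actAlong_constOn fun e he => hW' (hs e he), actAlong_constOn fun e he => hW' (hr e he)]⟩

theorem of_S {W : Finset V} {q : E →₀ F} (hs : ∀ e ∈ q.support, G.s e ∈ W)
    (hr : ∀ e ∈ q.support, G.r e ∈ W) : HasLocalUnit ρ W (ρ.S q) :=
  ⟨by rw [← ρ.S_left, left_P_eq, actAlong_constOn hr, one_smul], fun W' hW' c => by
    rw [← ρ.S_left, ← ρ.S_right, left_P_eq, right_P_eq,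
      actAlong_constOn fun e he => hW' (hs e he), actAlong_constOn fun e he => hW' (hr e he)]⟩

end HasLocalUnit

theorem exists_vertices_of_edges (G : OrientedGraph V E) (q : E →₀ F) :
    ∃ W : Finset V, (∀ e ∈ q.support, G.s e ∈ W) ∧ ∀ e ∈ q.support, G.r e ∈ W := by
  classical
  refine ⟨q.support.image G.s ∪ q.support.image G.r, fun e he => ?_, fun e he => ?_⟩
  · exact Finset.mem_union_left _ (Finset.mem_image_of_mem _ he)
  · exact Finset.mem_union_right _ (Finset.mem_image_of_mem _ he)

/-- Generators involve finitely many vertices, and a sum or product is handled by the union of the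
two vertex sets. -/
theorem exists_hasLocalUnit_relCuntzPimsner (hX : (G.system F).FS)
    (J : TwoSidedIdeal (V →₀ F)) (hJ : (G.system F).IsPsiCompatible J)
    (x : RSystem.RelCuntzPimsner hX J hJ) :
    ∃ W, HasLocalUnit (RSystem.cuntzPimsnerRep hX J hJ) W x := by
  classical
  induction x using RSystem.relCuntzPimsner_induction with
  | hσ a => exact ⟨a.support, .of_σ subset_rfl⟩
  | hS p =>
    obtain ⟨W, hs, hr⟩ := G.exists_vertices_of_edges p
    exact ⟨W, .of_S hs hr⟩
  | hT q =>
    obtain ⟨W, hs, hr⟩ := G.exists_vertices_of_edges q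
    exact ⟨W, .of_T hs hr⟩
  | hadd x y hx hy =>
    obtain ⟨W₁, h₁⟩ := hx
    obtain ⟨W₂, h₂⟩ := hy
    exact ⟨W₁ ∪ W₂, (h₁.mono Finset.subset_union_left).add (h₂.mono Finset.subset_union_right)⟩
  | hneg x hx =>
    obtain ⟨W, h⟩ := hx
    exact ⟨W, h.neg⟩
  | hmul x y hx hy =>
    obtain ⟨W₁, h₁⟩ := hx
    obtain ⟨W₂, h₂⟩ := hy
    exact ⟨W₁ ∪ W₂, (h₁.mono Finset.subset_union_left).mul (h₂.mono Finset.subset_union_right)⟩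

variable {ρ} (hunit : ∀ x, ∃ W, HasLocalUnit ρ W x)

/-- Multiplication by a scalar `c`, which is multiplication by `σ (∑_{v ∈ W} c 1_v)` for every
sufficiently large finite set `W` of vertices. -/
@[reducible]
noncomputable def scalarSMul : SMul F B :=
  ⟨fun c x => ρ.σ (constOn (hunit x).choose c) * x⟩

/-- Compare the chosen set and $W$ with their union: the action is independent of the choice. -/
theorem scalarSMul_eq (c : F) {W : Finset V} {x : B} (h : HasLocalUnit ρ W x) :
    (scalarSMul hunit).smul c x = ρ.σ (constOn W c) * x := by
  classical
  change ρ.σ (constOn (hunit x).choose c) * x = _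
  rw [← (hunit x).choose_spec.σ_mul_eq (Finset.subset_union_left (s₂ := W)),
    h.σ_mul_eq Finset.subset_union_right]

/-- A ring generated by a covariant representation is a module over the scalars. -/
@[reducible]
noncomputable def scalarModule : Module F B where
  toSMul := scalarSMul hunit
  one_smul x := (hunit x).choose_spec.1
  mul_smul c d x := by
    obtain ⟨W, h⟩ := hunit x
    -- The same $W$ works for $dx$, so both scalar multiplications can be computed with it.
    have h' : HasLocalUnit ρ W (ρ.σ (constOn W d) * x) :=
      (HasLocalUnit.of_σ (Finsupp.support_indicator_subset _ _)).mul h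
    change (scalarSMul hunit).smul _ _ = (scalarSMul hunit).smul _ ((scalarSMul hunit).smul _ _)
    rw [scalarSMul_eq hunit _ h, scalarSMul_eq hunit _ h, scalarSMul_eq hunit _ h', ← mul_assoc,
      ← map_mul, constOn_mul_constOn subset_rfl]
  smul_zero c := mul_zero _
  zero_smul x := by
    have h : constOn (hunit x).choose (0 : F) = 0 := by
      ext v
      by_cases hv : v ∈ (hunit x).choose
      · simp [constOn_apply_of_mem hv]
      · simp [constOn_apply_of_notMem hv]
    change ρ.σ (constOn (hunit x).choose 0) * x = 0
    rw [h, map_zero, zero_mul]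
  add_smul c d x := by
    change ρ.σ _ * x = ρ.σ _ * x + ρ.σ _ * x
    rw [constOn_add, map_add, add_mul]
  smul_add c x y := by
    classical
    obtain ⟨W₁, h₁⟩ := hunit x
    obtain ⟨W₂, h₂⟩ := hunit y
    have hx := h₁.mono (Finset.subset_union_left (s₂ := W₂))
    have hy := h₂.mono (Finset.subset_union_right (s₁ := W₁))
    change (scalarSMul hunit).smul _ _ =
      (scalarSMul hunit).smul _ _ + (scalarSMul hunit).smul _ _
    rw [scalarSMul_eq hunit _ hx, scalarSMul_eq hunit _ hy, scalarSMul_eq hunit _ (hx.add hy),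
      mul_add]

theorem scalarModule_smul_eq (c : F) {W : Finset V} {x : B} (h : HasLocalUnit ρ W x) :
    letI := scalarModule hunit
    c • x = ρ.σ (constOn W c) * x :=
  scalarSMul_eq hunit c h

/-- Over a common $W$, the first equality is associativity; the second moves $\sigma(c\mathbf 1_W)$
past $x$, which is what the commutation half of `HasLocalUnit` is for. -/
theorem scalarModule_smul_mul (c : F) (x y : B) :
    letI := scalarModule hunit
    c • (x * y) = (c • x) * y ∧ c • (x * y) = x * (c • y) := by
  classical
  obtain ⟨W₁, h₁⟩ := hunit x
  obtain ⟨W₂, h₂⟩ := hunit y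
  have hx := h₁.mono (Finset.subset_union_left (s₂ := W₂))
  have hy := h₂.mono (Finset.subset_union_right (s₁ := W₁))
  rw [scalarModule_smul_eq hunit c hx, scalarModule_smul_eq hunit c hy,
    scalarModule_smul_eq hunit c (hx.mul hy), ← mul_assoc, ← mul_assoc, hx.2 _ subset_rfl]
  exact ⟨rfl, rfl⟩

theorem scalarModule_smul_σ (c : F) (a : V →₀ F) :
    letI := scalarModule hunit
    c • ρ.σ a = ρ.σ (c • a) := by
  rw [scalarModule_smul_eq hunit c (HasLocalUnit.of_σ subset_rfl), ← map_mul,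
    constOn_mul subset_rfl]

theorem scalarModule_smul_S (c : F) (p : E →₀ F) :
    letI := scalarModule hunit
    c • ρ.S p = ρ.S (c • p) := by
  obtain ⟨W, hs, hr⟩ := G.exists_vertices_of_edges p
  rw [scalarModule_smul_eq hunit c (HasLocalUnit.of_S hs hr), ← ρ.S_left, left_P_eq,
    actAlong_constOn hr]

theorem scalarModule_smul_T (c : F) (q : E →₀ F) :
    letI := scalarModule hunit
    c • ρ.T q = ρ.T (c • q) := by
  obtain ⟨W, hs, hr⟩ := G.exists_vertices_of_edges q
  rw [scalarModule_smul_eq hunit c (HasLocalUnit.of_T hs hr), ← ρ.T_left, left_Q_eq,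
    actAlong_constOn hs]

end

end OrientedGraph

/-! ### The isomorphism with the Leavitt path algebra -/

namespace OrientedGraph

variable {V E : Type*} (G : OrientedGraph V E) (F : Type*) [CommRing F]

theorem finsupp_apply_eq_linearCombination {α B : Type*} [AddCommGroup B] [Module F B]
    (f : (α →₀ F) →+ B) (hf : ∀ (c : F) a, f (c • a) = c • f a) (a : α →₀ F) :
    f a = Finsupp.linearCombination F (fun i => f (Finsupp.single i 1)) a := by
  induction a using Finsupp.induction_linear with
  | zero => simp
  | add a b ha hb => rw [map_add, map_add, ha, hb]
  | single i c =>
    rw [Finsupp.linearCombination_single, ← hf, Finsupp.smul_single, smul_eq_mul, mul_one]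

/-- The Cuntz–Pimsner ring of the system of a graph is the Leavitt path algebra. -/
theorem exists_cuntzPimsner_equiv_leavitt (hX : (G.system F).FS)
    (hJ : (G.system F).IsPsiCompatible (G.regularIdeal F)) :
    ∃ m : Module F (RSystem.RelCuntzPimsner hX (G.regularIdeal F) hJ),
      (∀ (c : F) (x y : RSystem.RelCuntzPimsner hX (G.regularIdeal F) hJ),
        c • (x * y) = (c • x) * y ∧ c • (x * y) = x * (c • y)) ∧
      (∀ (c : F) (a : V →₀ F),
        c • (RSystem.cuntzPimsnerRep hX (G.regularIdeal F) hJ).σ a =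
          (RSystem.cuntzPimsnerRep hX (G.regularIdeal F) hJ).σ (c • a)) ∧
      (∀ (c : F) (p : E →₀ F),
        c • (RSystem.cuntzPimsnerRep hX (G.regularIdeal F) hJ).S p =
          (RSystem.cuntzPimsnerRep hX (G.regularIdeal F) hJ).S (c • p)) ∧
      (∀ (c : F) (q : E →₀ F),
        c • (RSystem.cuntzPimsnerRep hX (G.regularIdeal F) hJ).T q =
          (RSystem.cuntzPimsnerRep hX (G.regularIdeal F) hJ).T (c • q)) ∧
      ∃ Φ : RSystem.RelCuntzPimsner hX (G.regularIdeal F) hJ ≃+* G.Leavitt F,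
        (∀ (c : F) (x : RSystem.RelCuntzPimsner hX (G.regularIdeal F) hJ),
          Φ (c • x) = c • Φ x) ∧
        (∀ v, Φ ((RSystem.cuntzPimsnerRep hX (G.regularIdeal F) hJ).σ (Finsupp.single v 1)) =
          G.pv F v) ∧
        (∀ e, Φ ((RSystem.cuntzPimsnerRep hX (G.regularIdeal F) hJ).T (Finsupp.single e 1)) =
          G.xe F e) ∧
        (∀ e, Φ ((RSystem.cuntzPimsnerRep hX (G.regularIdeal F) hJ).S (Finsupp.single e 1)) =
          G.ye F e) := by
  have hunit := exists_hasLocalUnit_relCuntzPimsner hX (G.regularIdeal F) hJ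
  let m := scalarModule hunit
  have hmul := scalarModule_smul_mul hunit
  have hσ := scalarModule_smul_σ hunit
  have hS := scalarModule_smul_S hunit
  have hT := scalarModule_smul_T hunit
  set ρ := RSystem.cuntzPimsnerRep hX (G.regularIdeal F) hJ
  have : IsScalarTower F (RSystem.RelCuntzPimsner hX (G.regularIdeal F) hJ)
      (RSystem.RelCuntzPimsner hX (G.regularIdeal F) hJ) := ⟨fun c x y => (hmul c x y).1.symm⟩
  have : SMulCommClass F (RSystem.RelCuntzPimsner hX (G.regularIdeal F) hJ)
      (RSystem.RelCuntzPimsner hX (G.regularIdeal F) hJ) := ⟨fun c x y => (hmul c x y).2⟩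
  have hL := G.isLeavittFamily_leavitt F
  obtain ⟨η, hησ, hηT, hηS⟩ := RSystem.exists_relCuntzPimsner_lift hX (G.regularIdeal F) hJ
    (hL.rep F) fun a ha => by
      -- What remains is the relation $p_v=\sum x_ey_e$ multiplied by $c$.
      refine σ_eq_pi_of_single (hL.rep F) hX (fun v c hfin hne => ?_) a ha _
      simp only [hL.rep_σ F, hL.rep_T F, hL.rep_S F, Finsupp.linearCombination_single, one_smul,
        smul_mul_assoc, hL.vertex_sum v hfin hne, Finset.smul_sum]
  have hfam := isLeavittFamily_of_rep ρ hX (RSystem.cuntzPimsnerRep_σ_eq_pi hX _ hJ)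
  obtain ⟨ζ, hζ, hζp, hζx, hζy⟩ := G.exists_leavitt_lift F hfam
  have hησ1 : ∀ v, η (ρ.σ (Finsupp.single v 1)) = G.pv F v := fun v => by
    rw [hησ, hL.rep_σ F, Finsupp.linearCombination_single, one_smul]
  have hηT1 : ∀ e, η (ρ.T (Finsupp.single e 1)) = G.xe F e := fun v => by
    rw [hηT, hL.rep_T F, Finsupp.linearCombination_single, one_smul]
  have hηS1 : ∀ e, η (ρ.S (Finsupp.single e 1)) = G.ye F e := fun v => by
    rw [hηS, hL.rep_S F, Finsupp.linearCombination_single, one_smul]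
  -- Bundled as a linear map, $\zeta$ can be moved through linear combinations of generators.
  let ζl : G.Leavitt F →ₗ[F] RSystem.RelCuntzPimsner hX (G.regularIdeal F) hJ :=
    { toFun := ζ, map_add' := map_add ζ, map_smul' := hζ }
  have hζl : ∀ z, ζ z = ζl z := fun _ => rfl
  have hleft : ∀ x, ζ (η x) = x := by
    intro x
    induction x using RSystem.relCuntzPimsner_induction with
    | hσ a =>
      rw [hησ, hL.rep_σ F, hζl, Finsupp.apply_linearCombination]
      have h : ρ.σ a = Finsupp.linearCombination F (fun v => ρ.σ (Finsupp.single v 1)) a :=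
        finsupp_apply_eq_linearCombination F (AddMonoidHomClass.toAddMonoidHom ρ.σ)
          (fun c a => (hσ c a).symm) a
      refine Eq.trans ?_ h.symm
      congr 2
      exact funext hζp
    | hS p =>
      rw [hηS, hL.rep_S F, hζl, Finsupp.apply_linearCombination]
      refine Eq.trans ?_ (finsupp_apply_eq_linearCombination F ρ.S
        (fun c a => (hS c a).symm) p).symm
      congr 2
      exact funext hζy
    | hT q =>
      rw [hηT, hL.rep_T F, hζl, Finsupp.apply_linearCombination]
      refine Eq.trans ?_ (finsupp_apply_eq_linearCombination F ρ.T
        (fun c a => (hT c a).symm) q).symm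
      congr 2
      exact funext hζx
    | hadd x y hx hy => rw [map_add, map_add, hx, hy]
    | hneg x hx => rw [map_neg, map_neg, hx]
    | hmul x y hx hy => rw [map_mul, map_mul, hx, hy]
  -- The universal property makes $\eta$ only a ring homomorphism. Linearity follows from
  -- $cx=\sigma(c\mathbf 1_W)x$, since $\eta\circ\sigma$ is linear on $R$.
  have hlin : ∀ (c : F) x, η (c • x) = c • η x := by
    intro c x
    obtain ⟨W, hW⟩ := hunit x
    have h1 : η (ρ.σ (constOn W c)) = c • η (ρ.σ (constOn W 1)) := by
      have h2 : (constOn W c : V →₀ F) = c • constOn W 1 := by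
        rw [smul_constOn, mul_one]
      rw [h2, hησ, hησ, hL.rep_σ F, hL.rep_σ F, map_smul]
    rw [scalarModule_smul_eq hunit c hW, map_mul, h1, smul_mul_assoc, ← map_mul, hW.1]
  have hright : ∀ z, η (ζ z) = z := by
    intro z
    induction z using G.leavitt_induction F with
    | hpv v => rw [hζp, hησ1]
    | hxe e => rw [hζx, hηT1]
    | hye e => rw [hζy, hηS1]
    | hzero => rw [map_zero, map_zero]
    | hadd x y hx hy => rw [map_add, map_add, hx, hy]
    | hsmul c x hx => rw [hζ, hlin, hx]
    | hmul x y hx hy => rw [map_mul, map_mul, hx, hy]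
  exact ⟨m, hmul, hσ, hS, hT,
    { toFun := η, invFun := ζ, left_inv := hleft, right_inv := hright,
      map_mul' := map_mul η, map_add' := map_add η }, hlin, hησ1, hηT1, hηS1⟩

end OrientedGraph

theorem mainTheorem9 {V E : Type*} (G : OrientedGraph V E) (F : Type*) [CommRing F] :
    {a | (G.system F).Delta a ∈ (G.system F).finiteRank} =
        (G.vertexSpan F {v | {e | G.s e = v}.Finite} : Set (V →₀ F)) ∧
    {a | (G.system F).Delta a = 0} =
        (G.vertexSpan F {v | {e | G.s e = v} = ∅} : Set (V →₀ F)) ∧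
    {a | ∀ b, (G.system F).Delta b = 0 → a * b = 0 ∧ b * a = 0} =
        (G.vertexSpan F {v | {e | G.s e = v}.Nonempty} : Set (V →₀ F)) ∧
    ∃ (hFS : (G.system F).FS) (J : TwoSidedIdeal (V →₀ F))
      (hJ : (G.system F).IsUniquelyMaximal J),
      (J : Set (V →₀ F)) =
        {a | (G.system F).Delta a ∈ (G.system F).finiteRank} ∩
          {a | ∀ b, (G.system F).Delta b = 0 → a * b = 0 ∧ b * a = 0} ∧
      (J : Set (V →₀ F)) =
        (G.vertexSpan F {v | {e | G.s e = v}.Nonempty ∧ {e | G.s e = v}.Finite} :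
          Set (V →₀ F)) ∧
      ∃ m : Module F (RSystem.RelCuntzPimsner hFS J hJ.compatible),
        (∀ (c : F) (x y : RSystem.RelCuntzPimsner hFS J hJ.compatible),
          c • (x * y) = (c • x) * y ∧ c • (x * y) = x * (c • y)) ∧
        (∀ (c : F) (a : V →₀ F),
          c • (RSystem.cuntzPimsnerRep hFS J hJ.compatible).σ a =
            (RSystem.cuntzPimsnerRep hFS J hJ.compatible).σ (c • a)) ∧
        (∀ (c : F) (p : E →₀ F),
          c • (RSystem.cuntzPimsnerRep hFS J hJ.compatible).S p =
            (RSystem.cuntzPimsnerRep hFS J hJ.compatible).S (c • p)) ∧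
        (∀ (c : F) (q : E →₀ F),
          c • (RSystem.cuntzPimsnerRep hFS J hJ.compatible).T q =
            (RSystem.cuntzPimsnerRep hFS J hJ.compatible).T (c • q)) ∧
        ∃ Φ : RSystem.RelCuntzPimsner hFS J hJ.compatible ≃+* G.Leavitt F,
          (∀ (c : F) (x : RSystem.RelCuntzPimsner hFS J hJ.compatible), Φ (c • x) = c • Φ x) ∧
          (∀ v, Φ ((RSystem.cuntzPimsnerRep hFS J hJ.compatible).σ (Finsupp.single v 1)) =
            G.pv F v) ∧
          (∀ e, Φ ((RSystem.cuntzPimsnerRep hFS J hJ.compatible).T (Finsupp.single e 1)) =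
            G.xe F e) ∧
          (∀ e, Φ ((RSystem.cuntzPimsnerRep hFS J hJ.compatible).S (Finsupp.single e 1)) =
            G.ye F e) := by
  have h1 : {a | (G.system F).Delta a ∈ (G.system F).finiteRank} =
      (G.vertexSpan F {v | {e | G.s e = v}.Finite} : Set (V →₀ F)) := by
    ext a
    exact (G.Delta_mem_finiteRank_iff F).trans (G.mem_vertexSpan_iff F).symm
  have h3 : {a | ∀ b, (G.system F).Delta b = 0 → a * b = 0 ∧ b * a = 0} =
      (G.vertexSpan F {v | {e | G.s e = v}.Nonempty} : Set (V →₀ F)) := by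
    ext a
    exact (G.perp_ker_Delta_iff F).trans (G.mem_vertexSpan_iff F).symm
  refine ⟨h1, ?_, h3, G.system_FS F, G.regularIdeal F, G.isUniquelyMaximal_regularIdeal F, ?_,
    G.coe_regularIdeal F, G.exists_cuntzPimsner_equiv_leavitt F _ _⟩
  · ext a
    refine (G.Delta_eq_zero_iff F).trans (Iff.trans ?_ (G.mem_vertexSpan_iff F).symm)
    constructor
    · intro h v hv
      refine Set.eq_empty_of_forall_notMem ?_
      rintro e rfl
      exact hv (h e)
    · intro h e
      by_contra he
      exact Set.notMem_empty e ((h _ he).subset rfl)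
  · ext a
    refine (G.mem_regularIdeal_iff F).trans ?_
    refine Iff.trans ?_ (and_congr (G.Delta_mem_finiteRank_iff F)
      (G.perp_ker_Delta_iff F)).symm
    exact ⟨fun h => ⟨fun v hv => (h v hv).2, fun v hv => (h v hv).1⟩,
      fun h v hv => ⟨h.2 v hv, h.1 v hv⟩⟩
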